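/- **Setting.** Fix integers $k,m\ge 1$, $\mathbb K=\mathbb R$ or $\mathbb C$, and an open set $D\subset\mathbb K$ with $D+1=D$. The independent times are $t_n$ ($n\ge1$), $\bar t_n$ ($n\ge 1$, $m\nmid n$) and $x_n$ ($n\ge1$), and we put $\bar t_{jm}=t_{jk}$ ($j\ge1$) and $x_0=s$. All functions below are formal power series in the times whose coefficients are functions of $s\in D$, infinitely differentiable over $\mathbb K$ and with values in $\mathbb C$. Let $(\Lambda f)(s)=f(s+1)$, and for a difference operator $A=\sum_{i\in\mathbb Z}a_i\Lambda^i$ let $A_+=\sum_{i\ge0}a_i\Lambda^i$, $A_-=\sum_{i<0}a_i\Lambda^i$. A derivation applied to an operator acts on its coefficients. A solution of the extended bigraded Toda hierarchy (EBTH) is a pair of operators $$W=1+\sum_{i\ge1}w_i\Lambda^{-i},\qquad \bar W=\sum_{i\ge0}\bar w_i\Lambda^{i}\quad(\bar w_0\text{ invertible})$$ with $L:=W\Lambda^kW^{-1}=\bar W\Lambda^{-m}\bar W^{-1}$ such that, with $L^{n/k}=W\Lambda^nW^{-1}$, $L^{n/m}=\bar W\Lambda^{-n}\bar W^{-1}$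 and $\log L=-\tfrac12(\partial_sW)W^{-1}+\tfrac12(\partial_s\bar W)\bar W^{-1}$, $$\begin{aligned} \partial_{t_n}W&=-(L^{n/k})_-W,&\partial_{t_n}\bar W&=(L^{n/k})_+\bar W&&(n\ge1),\\ \partial_{\bar t_n}W&=-(L^{n/m})_-W,&\partial_{\bar t_n}\bar W&=(L^{n/m})_+\bar W&&(n\ge1),\\ \partial_{x_n}W&=-(2L^n\log L)_-W,&\partial_{x_n}\bar W&=(2L^n\log L)_+\bar W&&(n\ge0). \end{aligned}$$ Let $[z]=(z,z^2/2,z^3/3,\dots)$. The expression $\tau(s,\boldsymbol t-[z^{-1}])$ denotes the formal power series $\exp\bigl(-\sum_{n\ge1}\tfrac{z^{-n}}{n}\partial_{t_n}\bigr)\tau$ in $z^{-1}$ (all $t_n$, $n\ge1$, are shifted), and $\tau(s,\bar{\boldsymbol t}+[z])$ the formal power series $\exp\bigl(\sum_{n\ge1}\tfrac{z^{n}}{n}\partial_{\bar t_n}\bigr)\tau$ in $z$ (all $\bar t_n$, $n\ge1$, are shifted); variables that are not shifted are omitted from the notation. Repeated shifts are defined by composition. A function $\tau$, with $\tau(s,\cdot)\ne0$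 for every $s\in D$, is a tau-function of the EBTH if for some solution $(W,\bar W)$ $$1+\sum_{i\ge1}w_iz^{-i}=\frac{\tau(s,\boldsymbol t-[z^{-1}])}{\tau(s)},\qquad \sum_{i\ge0}\bar w_iz^{i}=\frac{\tau(s+1,\bar{\boldsymbol t}+[z])}{\tau(s)}$$ (that is, these identities hold, coefficient by coefficient, after multiplication by $\tau(s)$). **Theorem.** Every tau-function $\tau$ of the EBTH satisfies the difference Fay identities $$(\lambda-\mu)\,\tau(s)\,\tau(s-1,\boldsymbol t-[\lambda^{-1}]-[\mu^{-1}])=\lambda\,\tau(s,\boldsymbol t-[\lambda^{-1}])\,\tau(s-1,\boldsymbol t-[\mu^{-1}])-\mu\,\tau(s,\boldsymbol t-[\mu^{-1}])\,\tau(s-1,\boldsymbol t-[\lambda^{-1}])\tag{1}$$ and $$(\lambda-\mu)\,\tau(s+1,\bar{\boldsymbol t}+[\lambda]+[\mu])\,\tau(s)=\lambda\,\tau(s+1,\bar{\boldsymbol t}+[\lambda])\,\tau(s,\bar{\boldsymbol t}+[\mu])-\mu\,\tau(s+1,\bar{\boldsymbol t}+[\mu])\,\tau(s,\bar{\boldsymbol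 t}+[\lambda]).\tag{2}$$ Here (1) holds as an identity of formal series in $\lambda^{-1},\mu^{-1}$ (after multiplication by $\lambda^{-1}\mu^{-1}$, of formal power series), and (2) as an identity of formal power series in $\lambda,\mu$. Moreover, for all complex numbers $\lambda,\mu\in\mathbb C^*$ and every $s\in D$ for which the series in $\lambda^{-1},\mu^{-1}$ (respectively in $\lambda,\mu$) expressing the shifted functions in (1) (respectively (2)) converge absolutely, coefficient by coefficient in the times, (1) (respectively (2)) holds for the sums of these series. -/

import Mathlib

open scoped ContDiff

namespace EBTH

/-! ### Functions of the variables `s`, `t`, `tbar`, `x`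

The variable `s` is a number, in an open set that is stable under `s ↦ s + 1` and `s ↦ s - 1`;
the times are formal variables.  A function is a formal power series in the times whose
coefficients are functions of `s` (see `IsSmooth` for their regularity). -/

/-- An open subset of `𝕜` (`𝕜 = ℝ` or `𝕜 = ℂ`) stable under `s ↦ s + 1` and `s ↦ s - 1`: the
domain of the variable `s`. -/
structure ShiftDomain (𝕜 : Type*) [RCLike 𝕜] where
  carrier : Set 𝕜
  isOpen_carrier : IsOpen carrier
  add_one_mem_iff : ∀ s : 𝕜, s + 1 ∈ carrier ↔ s ∈ carrier

theorem ShiftDomain.add_int_mem {𝕜 : Type*} [RCLike 𝕜] (D : ShiftDomain 𝕜) {s : 𝕜}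
    (hs : s ∈ D.carrier) (i : ℤ) : s + (i : 𝕜) ∈ D.carrier := by
  induction i with
  | zero => simpa using hs
  | succ i ih =>
    have h := (D.add_one_mem_iff (s + ((i : ℤ) : 𝕜))).2 ih
    simpa [add_assoc] using h
  | pred i ih =>
    refine (D.add_one_mem_iff _).1 ?_
    have e : s + ((-(i : ℤ) - 1 : ℤ) : 𝕜) + 1 = s + ((-(i : ℤ) : ℤ) : 𝕜) := by
      push_cast
      ring
    rw [e]
    exact ih

/-- The independent times: `t n` for all `n ≥ 1`, `tbar n` for `n ≥ 1` not divisible by `m`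
(because of the identification `tbar (n m) = t (n k)`), and `x n` for `n ≥ 1`
(`x 0` is identified with `s`). -/
inductive TimeVar (m : ℕ+) : Type
  | t (n : ℕ+) : TimeVar m
  | tbar (n : ℕ+) (hn : ¬ (m : ℕ) ∣ (n : ℕ)) : TimeVar m
  | x (n : ℕ+) : TimeVar m

theorem quot_mul_pos {m n : ℕ+} (k : ℕ+) (h : (m : ℕ) ∣ (n : ℕ)) :
    0 < (n : ℕ) / (m : ℕ) * (k : ℕ) :=
  Nat.mul_pos (Nat.div_pos (Nat.le_of_dvd n.pos h) m.pos) k.pos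

open Classical in
/-- The variable `tbar n` for an arbitrary `n ≥ 1`, with the convention `tbar (j m) = t (j k)`. -/
noncomputable def tbarVar (k m n : ℕ+) : TimeVar m :=
  if h : (m : ℕ) ∣ (n : ℕ) then .t ⟨(n : ℕ) / (m : ℕ) * (k : ℕ), quot_mul_pos k h⟩
  else .tbar n h

/-- Functions of `s` and of the times: formal power series in the times whose coefficients are
functions of `s ∈ D`. -/
abbrev Fn {𝕜 : Type*} [RCLike 𝕜] (D : ShiftDomain 𝕜) (m : ℕ+) : Type _ :=
  MvPowerSeries (TimeVar m) (D.carrier → ℂ)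

section

variable {𝕜 : Type*} [RCLike 𝕜] {D : ShiftDomain 𝕜} {m : ℕ+}

/-- All coefficients are infinitely differentiable functions of `s` on the domain `D`
(that is, holomorphic functions if `𝕜 = ℂ`). -/
def IsSmooth [NormedSpace 𝕜 ℂ] (f : Fn D m) : Prop :=
  ∀ α, ContDiffOn 𝕜 ∞ (Function.extend Subtype.val (MvPowerSeries.coeff α f) 0) D.carrier

/-- `(Λ^i f)(s) = f(s + i)`. -/
def shift (i : ℤ) (f : Fn D m) : Fn D m :=
  fun α s => MvPowerSeries.coeff α f ⟨(s : 𝕜) + (i : 𝕜), D.add_int_mem s.2 i⟩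

/-- The partial derivative with respect to `s`. -/
noncomputable def dS [NormedSpace 𝕜 ℂ] (f : Fn D m) : Fn D m :=
  fun α s => deriv (Function.extend Subtype.val (MvPowerSeries.coeff α f) 0) (s : 𝕜)

/-- The partial derivative with respect to one of the times. -/
noncomputable def dVar (v : TimeVar m) (f : Fn D m) : Fn D m :=
  MvPowerSeries.pderiv (D.carrier → ℂ) v f

/-- `∂/∂t_n`, `n ≥ 1`. -/
noncomputable def dT (n : ℕ+) (f : Fn D m) : Fn D m := dVar (.t n) f

/-- `∂/∂tbar_n`, `n ≥ 1`; recall that `tbar (j m) = t (j k)`. -/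
noncomputable def dTbar (k : ℕ+) (n : ℕ+) (f : Fn D m) : Fn D m := dVar (tbarVar k m n) f

/-- `∂/∂x_n`, `n ≥ 0`; recall that `x_0 = s`. -/
noncomputable def dX [NormedSpace 𝕜 ℂ] : ℕ → Fn D m → Fn D m
  | 0, f => dS f
  | n + 1, f => dVar (.x n.succPNat) f

/-! ### Difference operators -/

/-- Formal difference operators `∑_{i ∈ ℤ} a_i Λ^i`, given by their coefficients `i ↦ a_i`. -/
abbrev DiffOp (D : ShiftDomain 𝕜) (m : ℕ+) : Type _ := ℤ → Fn D m

namespace DiffOp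

/-- The product determined by `(a Λ^i)(b Λ^j) = a Λ^i(b) Λ^(i+j)`.  It is the usual one whenever
the sums over `i` below are finite: for two operators whose powers of `Λ` are bounded from above,
for two operators whose powers of `Λ` are bounded from below, and if one of the factors is a finite
sum. Only such products are used. -/
noncomputable def mul (A B : DiffOp D m) : DiffOp D m :=
  fun j => ∑ᶠ i : ℤ, A i * shift i (B (j - i))

/-- The operator `Λ^n`. -/
noncomputable def lam (n : ℤ) : DiffOp D m := Pi.single n 1

/-- The projection `A ↦ A_+` on the part with nonnegative powers of `Λ`. -/
def plus (A : DiffOp D m) : DiffOp D m := fun i => if 0 ≤ i then A i else 0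

/-- The projection `A ↦ A_-` on the part with negative powers of `Λ`. -/
def minus (A : DiffOp D m) : DiffOp D m := fun i => if i < 0 then A i else 0

/-- The power `A^n`. -/
noncomputable def npow (A : DiffOp D m) : ℕ → DiffOp D m
  | 0 => lam 0
  | n + 1 => mul A (npow A n)

/-- Apply an operation to all coefficients (used for the derivatives of operators). -/
def mapCoeff (δ : Fn D m → Fn D m) (A : DiffOp D m) : DiffOp D m := fun i => δ (A i)

end DiffOp

open DiffOp

/-- Wave (dressing) operators `W = 1 + ∑_{i ≥ 1} w_i Λ^(-i)` and `Wbar = ∑_{i ≥ 0} wbar_i Λ^i`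
together with their (unique) inverses `Winv`, `Wbarinv`. The operator `Wbar` has an inverse of the
same form if and only if `wbar_0` is invertible. -/
structure WaveOps [NormedSpace 𝕜 ℂ] (D : ShiftDomain 𝕜) (m : ℕ+) where
  W : DiffOp D m
  Winv : DiffOp D m
  Wbar : DiffOp D m
  Wbarinv : DiffOp D m
  smooth_W : ∀ i, IsSmooth (W i)
  smooth_Wbar : ∀ i, IsSmooth (Wbar i)
  W_zero : W 0 = 1
  W_pos : ∀ i : ℤ, 0 < i → W i = 0
  Winv_pos : ∀ i : ℤ, 0 < i → Winv i = 0
  Wbar_neg : ∀ i : ℤ, i < 0 → Wbar i = 0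
  Wbarinv_neg : ∀ i : ℤ, i < 0 → Wbarinv i = 0
  mul_Winv : mul W Winv = lam 0
  Winv_mul : mul Winv W = lam 0
  mul_Wbarinv : mul Wbar Wbarinv = lam 0
  Wbarinv_mul : mul Wbarinv Wbar = lam 0

namespace WaveOps

variable [NormedSpace 𝕜 ℂ] (P : WaveOps D m)

/-- `W Λ^n W⁻¹`, the fractional power `L^(n/k)`. -/
noncomputable def fracPow (n : ℕ) : DiffOp D m := mul (mul P.W (lam (n : ℤ))) P.Winv

/-- `Wbar Λ^(-n) Wbar⁻¹`, the fractional power `L^(n/m)`. -/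
noncomputable def fracPowBar (n : ℕ) : DiffOp D m :=
  mul (mul P.Wbar (lam (-(n : ℤ)))) P.Wbarinv

/-- The Lax operator `L = W Λ^k W⁻¹`. -/
noncomputable def lax (k : ℕ+) : DiffOp D m := P.fracPow k

/-- `log L = -(1/2) (∂W/∂s) W⁻¹ + (1/2) (∂Wbar/∂s) Wbar⁻¹`. -/
noncomputable def logL : DiffOp D m :=
  (-(1 / 2 : ℂ)) • mul (mapCoeff dS P.W) P.Winv +
    (1 / 2 : ℂ) • mul (mapCoeff dS P.Wbar) P.Wbarinv

/-- `2 L^n log L`. -/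
noncomputable def powLog (k : ℕ+) (n : ℕ) : DiffOp D m :=
  (2 : ℂ) • mul (npow (P.lax k) n) P.logL

/-- The wave operators solve the extended bigraded Toda hierarchy: `W` and `Wbar` dress the same
Lax operator `L = W Λ^k W⁻¹ = Wbar Λ^(-m) Wbar⁻¹`, and they satisfy the flow equations
with respect to all variables. -/
structure IsSolution (k : ℕ+) : Prop where
  lax_eq : P.lax k = P.fracPowBar m
  flow_t_W : ∀ n : ℕ+,
    mapCoeff (dT n) P.W = -mul (minus (P.fracPow n)) P.W
  flow_t_Wbar : ∀ n : ℕ+,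
    mapCoeff (dT n) P.Wbar = mul (plus (P.fracPow n)) P.Wbar
  flow_tbar_W : ∀ n : ℕ+,
    mapCoeff (dTbar k n) P.W = -mul (minus (P.fracPowBar n)) P.W
  flow_tbar_Wbar : ∀ n : ℕ+,
    mapCoeff (dTbar k n) P.Wbar = mul (plus (P.fracPowBar n)) P.Wbar
  flow_x_W : ∀ n : ℕ,
    mapCoeff (dX n) P.W = -mul (minus (P.powLog k n)) P.W
  flow_x_Wbar : ∀ n : ℕ,
    mapCoeff (dX n) P.Wbar = mul (plus (P.powLog k n)) P.Wbar

end WaveOps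

/-! ### The shifts `t - [z⁻¹]` and `tbar + [z]` -/

/-- Multiplication by `∑_{n ≥ 1} c (y^n / n) δ_n` on formal power series in `y` (given by the
sequences of their coefficients). -/
noncomputable def miwaGen (c : ℂ) (δ : ℕ+ → Fn D m → Fn D m) (g : ℕ → Fn D m) : ℕ → Fn D m :=
  fun i => ∑ n ∈ Finset.range i, (c / ((n : ℂ) + 1)) • δ n.succPNat (g (i - (n + 1)))

/-- The coefficient of `y^i` in `exp (∑_{n ≥ 1} c (y^n / n) δ_n) f`.  The terms of
order `j > i` of the exponential series do not contribute to it.  By Taylor's formula,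
for `c = -1`, `δ_n = ∂/∂t_n`, `y = z⁻¹` this is the expansion of `f` at `t - [z⁻¹]`,
and for `c = 1`, `δ_n = ∂/∂tbar_n`, `y = z` it is the expansion of `f` at `tbar + [z]`. -/
noncomputable def miwa (c : ℂ) (δ : ℕ+ → Fn D m → Fn D m) (f : Fn D m) (i : ℕ) : Fn D m :=
  ∑ j ∈ Finset.range (i + 1),
    ((j.factorial : ℂ)⁻¹) • ((miwaGen c δ)^[j] (fun l => if l = 0 then f else 0)) i

/-- The coefficient of `z^(-i)` in `f(t - [z⁻¹])`. -/
noncomputable def shiftT (f : Fn D m) (i : ℕ) : Fn D m := miwa (-1) dT f i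

/-- The coefficient of `z^i` in `f(tbar + [z])`. -/
noncomputable def shiftTbar (k : ℕ+) (f : Fn D m) (i : ℕ) : Fn D m := miwa 1 (dTbar k) f i

/-- `τ` is a tau-function of the extended bigraded Toda hierarchy: for some wave operators solving
the hierarchy, with symbols `w = ∑ w_i z^(-i)` and `wbar = ∑ wbar_i z^i`,
`w = τ(s, t - [z⁻¹]) / τ(s, t)` and `wbar = τ(s + 1, tbar + [z]) / τ(s, t)` coefficientwise. -/
structure IsTau [NormedSpace 𝕜 ℂ] (k : ℕ+) (τ : Fn D m) : Prop where
  smooth : IsSmooth τ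
  ne_zero : ∀ s, MvPowerSeries.map (Pi.evalRingHom (fun _ => ℂ) s) τ ≠ 0
  exists_wave : ∃ P : WaveOps D m, P.IsSolution k ∧
    (∀ i : ℕ, τ * P.W (-(i : ℤ)) = shiftT τ i) ∧
    (∀ i : ℕ, τ * P.Wbar (i : ℤ) = shift 1 (shiftTbar k τ i))

/-! ### Formal series in two parameters

Below `E f i` is the coefficient of `y^i` in the series obtained from `f` by a shift with
parameter `y`, for example `E = shiftT` or `E = shiftTbar k`. -/

/-- The shift by the first parameter, as a series in the two parameters. -/
noncomputable def fstSeries (E : Fn D m → ℕ → Fn D m) (f : Fn D m) :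
    MvPowerSeries (Fin 2) (Fn D m) :=
  fun n => if n 1 = 0 then E f (n 0) else 0

/-- The shift by the second parameter, as a series in the two parameters. -/
noncomputable def sndSeries (E : Fn D m → ℕ → Fn D m) (f : Fn D m) :
    MvPowerSeries (Fin 2) (Fn D m) :=
  fun n => if n 0 = 0 then E f (n 1) else 0

/-- The shift by both parameters. -/
noncomputable def bothSeries (E : Fn D m → ℕ → Fn D m) (f : Fn D m) :
    MvPowerSeries (Fin 2) (Fn D m) :=
  fun n => E (E f (n 1)) (n 0)

/-! ### Numerical values of the parameters -/

/-- `f` at a given `s`, a formal power series in the times with complex coefficients. -/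
noncomputable def evalS (s : D.carrier) (f : Fn D m) : MvPowerSeries (TimeVar m) ℂ :=
  MvPowerSeries.map (Pi.evalRingHom (fun _ => ℂ) s) f

/-- At the given `s`, the series for the shift of `f` converges absolutely at `y`. -/
def Conv (E : Fn D m → ℕ → Fn D m) (f : Fn D m) (s : D.carrier) (y : ℂ) : Prop :=
  ∀ α, Summable fun i : ℕ => MvPowerSeries.coeff α (evalS s (E f i)) * y ^ i

/-- At the given `s`, the double series for the twofold shift of `f` converges absolutely
at `(y, y')`. -/
def Conv₂ (E : Fn D m → ℕ → Fn D m) (f : Fn D m) (s : D.carrier) (y y' : ℂ) : Prop :=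
  ∀ α, Summable fun p : ℕ × ℕ =>
    MvPowerSeries.coeff α (evalS s (E (E f p.2) p.1)) * (y ^ p.1 * y' ^ p.2)

/-- The sum of the series for the shift of `f`. -/
noncomputable def value (E : Fn D m → ℕ → Fn D m) (f : Fn D m) (s : D.carrier) (y : ℂ) :
    MvPowerSeries (TimeVar m) ℂ :=
  fun α => ∑' i : ℕ, MvPowerSeries.coeff α (evalS s (E f i)) * y ^ i

/-- The sum of the double series for the twofold shift of `f`. -/
noncomputable def value₂ (E : Fn D m → ℕ → Fn D m) (f : Fn D m) (s : D.carrier) (y y' : ℂ) :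
    MvPowerSeries (TimeVar m) ℂ :=
  fun α => ∑' p : ℕ × ℕ,
    MvPowerSeries.coeff α (evalS s (E (E f p.2) p.1)) * (y ^ p.1 * y' ^ p.2)

end

end EBTH

/-!
The proof is the elimination of an auxiliary linear equation. For the `t`-flows, the equation
`∂W/∂t_n = (L^(n/k))_+ W - W Λ^n` shows that `W(t - [z⁻¹]) (1 - z⁻¹ Λ)`, as a series in `y = z⁻¹`,
solves a linear differential equation in `y` whose coefficients are difference operators of
nonnegative order. So it is the product of such an operator with `W(t)`. Its own order in `Λ` is at
most one, and therefore `W(t - [z⁻¹]) (1 - z⁻¹ Λ) = (P + Q Λ) W(t)` for functions `P`, `Q`. On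
symbols, with `y' = μ⁻¹`, this reads
`(y' - y) w(s, t - [z⁻¹], μ) = y' P w(s, μ) + Q w(s + 1, μ)`. At `μ = z` the left side vanishes,
which determines `P`; the coefficient of `Λ` determines `Q`. Insertion of the tau-function into the
resulting relation and multiplication by the denominators give the difference Fay identity.

The `tbar`-flows are the same with `Λ⁻¹` in place of `Λ`: the equation is
`∂Wbar/∂tbar_n = Wbar Λ^(-n) - (L^(n/m))_- Wbar`, and the series is
`Wbar(tbar + [z]) (1 - z Λ⁻¹)`. Both cases are instances of `IsDressing`, about a sequence `U` in a
commutative algebra with commuting derivations `δ_n` and an automorphism `σ`. The shift of the times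
is the exponential flow of the `δ_n` (`IsFlow`, `isFlow_exp`); it is a ring homomorphism because
the differential equation in `y` has a unique solution with given initial value. The auxiliary
linear equation is `IsDressing.exists_linear_relation`, and the elimination is `IsDressing.fay`. The
identity for numerical parameters follows from the formal one by summing absolutely convergent
series (`FayIdentity.numerical`).
-/

namespace EBTH

/-! ### Exponentials of derivations -/

section Flow

open PowerSeries Finset

theorem sum_antidiagonal_assoc {M : Type*} [AddCommMonoid M] (n : ℕ) (f : ℕ → ℕ → ℕ → M) :
    ∑ p ∈ antidiagonal n, ∑ q ∈ antidiagonal p.1, f q.1 q.2 p.2 =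
      ∑ p ∈ antidiagonal n, ∑ q ∈ antidiagonal p.2, f p.1 q.1 q.2 := by
  simp only [Finset.sum_sigma']
  apply Finset.sum_nbij' (fun ⟨⟨_, j⟩, ⟨k, l⟩⟩ ↦ ⟨(k, l + j), (l, j)⟩)
    (fun ⟨⟨i, _⟩, ⟨k, l⟩⟩ ↦ ⟨(i + k, l), (i, k)⟩)
  all_goals
    rintro ⟨⟨i, j⟩, ⟨k, l⟩⟩ h
    simp only [Finset.mem_sigma, HasAntidiagonal.mem_antidiagonal] at h
    obtain ⟨h1, h2⟩ := h
    subst h1 h2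
  all_goals simp [add_assoc]

theorem sum_antidiagonal_left_comm {M : Type*} [AddCommMonoid M] (n : ℕ) (f : ℕ → ℕ → ℕ → M) :
    ∑ p ∈ antidiagonal n, ∑ q ∈ antidiagonal p.2, f p.1 q.1 q.2 =
      ∑ p ∈ antidiagonal n, ∑ q ∈ antidiagonal p.2, f q.1 p.1 q.2 := by
  rw [← sum_antidiagonal_assoc n f, ← sum_antidiagonal_assoc n fun a b c => f b a c]
  exact Finset.sum_congr rfl fun p _ =>
    (Finset.Nat.sum_antidiagonal_swap (f := fun q => f q.1 q.2 p.2)).symm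

variable {R : Type*} [CommRing R] [Algebra ℂ R]

/-- The operator `∑ y^n δ_n` on power series in `y`, where the `δ_n` act on coefficients. -/
noncomputable def evol (δ : ℕ → Derivation ℂ R R) (F : R⟦X⟧) : R⟦X⟧ :=
  mk fun i => ∑ p ∈ antidiagonal i, δ p.1 (coeff p.2 F)

theorem coeff_evol (δ : ℕ → Derivation ℂ R R) (F : R⟦X⟧) (i : ℕ) :
    coeff i (evol δ F) = ∑ p ∈ antidiagonal i, δ p.1 (coeff p.2 F) := coeff_mk _ _

theorem evol_add (δ : ℕ → Derivation ℂ R R) (F G : R⟦X⟧) :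
    evol δ (F + G) = evol δ F + evol δ G := by
  ext i
  simp [coeff_evol, Finset.sum_add_distrib]

theorem evol_nsmul (δ : ℕ → Derivation ℂ R R) (n : ℕ) (F : R⟦X⟧) :
    evol δ (n • F) = n • evol δ F := by
  ext i
  simp only [coeff_evol, map_nsmul, Finset.smul_sum]

theorem evol_one (δ : ℕ → Derivation ℂ R R) : evol δ (1 : R⟦X⟧) = 0 := by
  ext i
  rw [coeff_evol]
  refine Finset.sum_eq_zero fun p _ => ?_
  rw [coeff_one]
  split_ifs <;> simp

theorem evol_mul (δ : ℕ → Derivation ℂ R R) (F G : R⟦X⟧) :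
    evol δ (F * G) = evol δ F * G + F * evol δ G := by
  ext i
  simp only [coeff_evol, coeff_mul, map_add, map_sum, Derivation.leibniz, smul_eq_mul,
    Finset.sum_add_distrib, Finset.sum_mul, Finset.mul_sum]
  rw [add_comm]
  congr 1
  · rw [sum_antidiagonal_assoc i fun a b c => δ a (coeff b F) * coeff c G]
    simp only [mul_comm]
  · exact sum_antidiagonal_left_comm i fun a b c => coeff b F * δ a (coeff c G)

theorem evol_X_mul (δ : ℕ → Derivation ℂ R R) (F : R⟦X⟧) :
    evol δ (X * F) = X * evol δ F := by
  have : evol δ (X : R⟦X⟧) = 0 := by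
    ext i
    rw [coeff_evol]
    refine Finset.sum_eq_zero fun p _ => ?_
    rw [coeff_X]
    split_ifs <;> simp
  rw [evol_mul, this, zero_mul, zero_add]

theorem evol_comm {δ δ' : ℕ → Derivation ℂ R R}
    (h : ∀ a b f, δ a (δ' b f) = δ' b (δ a f)) (F : R⟦X⟧) :
    evol δ (evol δ' F) = evol δ' (evol δ F) := by
  ext i
  simp only [coeff_evol, map_sum, h]
  exact sum_antidiagonal_left_comm i fun a b c => δ' b (δ a (coeff c F))

/-- A solution of `dF/dy = ∑ y^n δ_n F` is determined by its value at `y = 0`. -/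
theorem eq_of_derivative_eq_evol {δ : ℕ → Derivation ℂ R R} {F G : R⟦X⟧}
    (hF : d⁄dX R F = evol δ F) (hG : d⁄dX R G = evol δ G)
    (h0 : constantCoeff F = constantCoeff G) : F = G := by
  ext i
  induction i using Nat.strong_induction_on with
  | _ i ih =>
    cases i with
    | zero => simpa using h0
    | succ i =>
      have e : ((i : ℂ) + 1) • (coeff (i + 1) F - coeff (i + 1) G) = 0 := by
        have h1 := congrArg (coeff i) hF
        have h2 := congrArg (coeff i) hG
        rw [coeff_derivative, coeff_evol] at h1 h2
        have h3 : ∑ p ∈ antidiagonal i, δ p.1 (coeff p.2 F) =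
            ∑ p ∈ antidiagonal i, δ p.1 (coeff p.2 G) :=
          Finset.sum_congr rfl fun p hp => by
            rw [ih p.2 (by have := mem_antidiagonal.1 hp; omega)]
        rw [Algebra.smul_def, map_add, map_natCast, map_one]
        linear_combination h1 - h2 + h3
      have hi : ((i : ℂ) + 1) ≠ 0 := by exact_mod_cast i.succ_ne_zero
      exact sub_eq_zero.1 ((smul_eq_zero_iff_right hi).1 e)

/-- `M f` is the series `exp (∑_{n ≥ 0} (y^(n+1) / (n+1)) δ_n) f` in `y`, characterised by the
differential equation in `y` that it satisfies when the `δ_n` commute. -/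
structure IsFlow (δ : ℕ → Derivation ℂ R R) (M : R → R⟦X⟧) : Prop where
  constantCoeff_apply : ∀ f, constantCoeff (M f) = f
  derivative_apply : ∀ f, d⁄dX R (M f) = evol δ (M f)

namespace IsFlow

variable {δ : ℕ → Derivation ℂ R R} {M : R → R⟦X⟧}

theorem map_one (h : IsFlow δ M) : M 1 = 1 :=
  eq_of_derivative_eq_evol (h.derivative_apply 1)
    (by rw [evol_one, Derivation.map_one_eq_zero]) (by simp [h.constantCoeff_apply])

theorem map_add (h : IsFlow δ M) (f g : R) : M (f + g) = M f + M g :=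
  eq_of_derivative_eq_evol (h.derivative_apply _)
    (by rw [evol_add, _root_.map_add, h.derivative_apply, h.derivative_apply])
    (by simp [h.constantCoeff_apply])

/-- The exponential of a derivation is multiplicative. -/
theorem map_mul (h : IsFlow δ M) (f g : R) : M (f * g) = M f * M g :=
  eq_of_derivative_eq_evol (h.derivative_apply _)
    (by rw [evol_mul, Derivation.leibniz, h.derivative_apply, h.derivative_apply, smul_eq_mul,
          smul_eq_mul]; ring)
    (by simp [h.constantCoeff_apply])

/-- The flow as a ring homomorphism. -/
noncomputable def toRingHom (h : IsFlow δ M) : R →+* R⟦X⟧ :=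
  RingHom.mk' ⟨⟨M, h.map_one⟩, h.map_mul⟩ h.map_add

@[simp] theorem toRingHom_apply (h : IsFlow δ M) (f : R) : h.toRingHom f = M f := rfl

theorem map_ringHom (h : IsFlow δ M) (σ : R →+* R) (hσ : ∀ n f, σ (δ n f) = δ n (σ f)) (f : R) :
    M (σ f) = PowerSeries.map σ (M f) :=
  eq_of_derivative_eq_evol (h.derivative_apply _)
    (by
      have := h.derivative_apply f
      ext i
      have := congrArg σ (congrArg (coeff i) this)
      simpa [coeff_derivative, coeff_evol, hσ] using this)
    (by
      rw [h.constantCoeff_apply, ← coeff_zero_eq_constantCoeff_apply, coeff_map,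
        coeff_zero_eq_constantCoeff_apply, h.constantCoeff_apply])

theorem coeff_apply_derivation (h : IsFlow δ M) (hδ : ∀ a b f, δ a (δ b f) = δ b (δ a f)) (n : ℕ)
    (f : R) (i : ℕ) : coeff i (M (δ n f)) = δ n (coeff i (M f)) := by
  have : M (δ n f) = PowerSeries.mk fun i => δ n (coeff i (M f)) := by
    refine eq_of_derivative_eq_evol (h.derivative_apply _) ?_ ?_
    · ext i
      have := congrArg (δ n) (congrArg (coeff i) (h.derivative_apply f))
      rw [coeff_derivative, coeff_evol, map_sum] at this
      simp only [hδ n] at this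
      rw [coeff_derivative, coeff_evol, coeff_mk]
      simp only [coeff_mk]
      rw [← this, Derivation.leibniz]
      have : δ n ((i : R) + 1) = 0 := by
        rw [_root_.map_add, Derivation.map_natCast, Derivation.map_one_eq_zero, add_zero]
      rw [this]
      simp [mul_comm]
    · rw [h.constantCoeff_apply, ← coeff_zero_eq_constantCoeff_apply, coeff_mk,
        coeff_zero_eq_constantCoeff_apply, h.constantCoeff_apply]
  rw [this, coeff_mk]

end IsFlow

end Flow

/-! ### The shifts of the times as exponentials -/

section Exp

open PowerSeries Finset

variable {R : Type*} [CommRing R] [Algebra ℂ R]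

/-- The family `δ_n / (n + 1)`. -/
noncomputable def integrated (δ : ℕ → Derivation ℂ R R) (n : ℕ) : Derivation ℂ R R :=
  (1 / ((n : ℂ) + 1)) • δ n

/-- The operator `∑_{n ≥ 0} (y^(n+1) / (n+1)) δ_n` on power series in `y`, the exponent of the
flow. -/
noncomputable def expGen (δ : ℕ → Derivation ℂ R R) (F : R⟦X⟧) : R⟦X⟧ :=
  X * evol (integrated δ) F

theorem derivative_expGen (δ : ℕ → Derivation ℂ R R) (F : R⟦X⟧) :
    d⁄dX R (expGen δ F) = evol δ F + expGen δ (d⁄dX R F) := by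
  have key : ∀ i, ∑ p ∈ antidiagonal i, integrated δ p.1 (coeff p.2 F) * (p.2 : R) =
      coeff i (expGen δ (d⁄dX R F)) := by
    intro i
    cases i with
    | zero => simp [expGen]
    | succ i =>
      rw [expGen, coeff_succ_X_mul, coeff_evol, Finset.Nat.sum_antidiagonal_succ']
      simp only [Nat.cast_zero, mul_zero, zero_add, coeff_derivative]
      refine Finset.sum_congr rfl fun p _ => ?_
      have : integrated δ p.1 ((p.2 : R) + 1) = 0 := by
        rw [map_add, Derivation.map_natCast, Derivation.map_one_eq_zero, add_zero]
      rw [Derivation.leibniz, this]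
      simp [mul_comm]
  ext i
  rw [map_add, ← key, coeff_derivative, expGen, coeff_succ_X_mul, coeff_evol, coeff_evol,
    Finset.sum_mul, ← Finset.sum_add_distrib]
  refine Finset.sum_congr rfl fun p hp => ?_
  have hi : (i : R) = p.1 + p.2 := by
    rw [← mem_antidiagonal.1 hp]
    push_cast
    rfl
  have h1 : integrated δ p.1 (coeff p.2 F) * ((p.1 : R) + 1) = δ p.1 (coeff p.2 F) := by
    have h0 : ((p.1 : ℂ) + 1) ≠ 0 := by exact_mod_cast p.1.succ_ne_zero
    have h2 : ((p.1 : R) + 1) = algebraMap ℂ R ((p.1 : ℂ) + 1) := by simp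
    rw [h2, mul_comm, ← Algebra.smul_def, integrated, Derivation.smul_apply, smul_smul,
      mul_one_div_cancel h0, one_smul]
  rw [hi, ← h1]
  ring

theorem expGen_nsmul (δ : ℕ → Derivation ℂ R R) (n : ℕ) (F : R⟦X⟧) :
    expGen δ (n • F) = n • expGen δ F := by
  rw [expGen, expGen, evol_nsmul, mul_smul_comm]

theorem expGen_evol {δ : ℕ → Derivation ℂ R R} (hδ : ∀ a b f, δ a (δ b f) = δ b (δ a f))
    (F : R⟦X⟧) : expGen δ (evol δ F) = evol δ (expGen δ F) := by
  rw [expGen, expGen, evol_X_mul, evol_comm]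
  intro a b f
  simp [integrated, hδ]

theorem derivative_iterate_expGen {δ : ℕ → Derivation ℂ R R}
    (hδ : ∀ a b f, δ a (δ b f) = δ b (δ a f)) (f : R) (j : ℕ) :
    d⁄dX R ((expGen δ)^[j + 1] (C f)) = (j + 1) • evol δ ((expGen δ)^[j] (C f)) := by
  induction j with
  | zero =>
    have : expGen δ (0 : R⟦X⟧) = 0 := by simpa using expGen_nsmul δ 0 (0 : R⟦X⟧)
    simp [derivative_expGen, this]
  | succ j ih =>
    rw [Function.iterate_succ_apply', derivative_expGen, ih, expGen_nsmul, expGen_evol hδ,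
      ← Function.iterate_succ_apply' (expGen δ)]
    rw [succ_nsmul _ (j + 1), add_comm]

theorem coeff_iterate_expGen_of_lt (δ : ℕ → Derivation ℂ R R) (F : R⟦X⟧) {i j : ℕ} (h : i < j) :
    coeff i ((expGen δ)^[j] F) = 0 := by
  induction j generalizing i with
  | zero => omega
  | succ j ih =>
    rw [Function.iterate_succ_apply', expGen]
    cases i with
    | zero => simp
    | succ i =>
      rw [coeff_succ_X_mul, coeff_evol]
      refine Finset.sum_eq_zero fun p hp => ?_
      rw [ih (by have := mem_antidiagonal.1 hp; omega), map_zero]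

/-- The exponential series is a flow. In the coefficient of `y^i` it can be truncated at the
exponent `i`, since the exponent of the flow is divisible by `y`. -/
theorem isFlow_exp {δ : ℕ → Derivation ℂ R R} (hδ : ∀ a b f, δ a (δ b f) = δ b (δ a f)) :
    IsFlow δ fun f => mk fun i =>
      ∑ j ∈ range (i + 1), ((j.factorial : ℂ)⁻¹) • coeff i ((expGen δ)^[j] (C f)) where
  constantCoeff_apply f := by
    rw [← coeff_zero_eq_constantCoeff_apply]
    simp
  derivative_apply f := by
    have trunc : ∀ i b : ℕ, b ≤ i →
        ∑ j ∈ range (b + 1), ((j.factorial : ℂ)⁻¹) • coeff b ((expGen δ)^[j] (C f)) =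
          ∑ j ∈ range (i + 1), ((j.factorial : ℂ)⁻¹) • coeff b ((expGen δ)^[j] (C f)) := by
      intro i b hb
      refine Finset.sum_subset (by intro; simp; omega) fun j _ hj => ?_
      rw [coeff_iterate_expGen_of_lt _ _ (by simpa using hj), smul_zero]
    ext i
    rw [coeff_derivative, coeff_mk, coeff_evol, Finset.sum_range_succ']
    have h0 : ((Nat.factorial 0 : ℂ)⁻¹) • coeff (i + 1) ((expGen δ)^[0] (C f)) = 0 := by
      simp
    rw [h0, add_zero, Finset.sum_mul]
    have h1 : ∀ j ∈ range (i + 1), (((j + 1).factorial : ℂ)⁻¹) •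
        coeff (i + 1) ((expGen δ)^[j + 1] (C f)) * ((i : R) + 1) =
        ((j.factorial : ℂ)⁻¹) • ∑ p ∈ antidiagonal i, δ p.1 (coeff p.2 ((expGen δ)^[j] (C f))) := by
      intro j _
      have h2 := congrArg (coeff i) (derivative_iterate_expGen hδ f j)
      rw [coeff_derivative, map_nsmul, coeff_evol] at h2
      rw [smul_mul_assoc, h2, ← Nat.cast_smul_eq_nsmul ℂ, smul_smul, Nat.factorial_succ]
      congr 1
      have : ((j + 1 : ℕ) : ℂ) ≠ 0 := by exact_mod_cast j.succ_ne_zero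
      push_cast at this ⊢
      field_simp
    rw [Finset.sum_congr rfl h1]
    simp only [Finset.smul_sum]
    rw [Finset.sum_comm]
    refine Finset.sum_congr rfl fun p hp => ?_
    rw [coeff_mk, trunc i p.2 (by have := mem_antidiagonal.1 hp; omega), map_sum]
    simp only [Derivation.map_smul]

end Exp

/-! ### The Fay identity for a sequence with a dressing flow -/

section Diagonal

open PowerSeries Finset

variable {R : Type*} [CommRing R]

/-- The sum `∑ y^n G_n` of a sequence of power series in `y`, that is, the value at `z = y` of the
series `∑ z^n G_n`. -/
noncomputable def diagSum (G : ℕ → R⟦X⟧) : R⟦X⟧ :=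
  mk fun l => ∑ p ∈ antidiagonal l, coeff p.2 (G p.1)

theorem coeff_diagSum (G : ℕ → R⟦X⟧) (l : ℕ) :
    coeff l (diagSum G) = ∑ p ∈ antidiagonal l, coeff p.2 (G p.1) := coeff_mk _ _

theorem diagSum_add (G H : ℕ → R⟦X⟧) :
    diagSum (fun n => G n + H n) = diagSum G + diagSum H := by
  ext l
  simp [coeff_diagSum, Finset.sum_add_distrib]

theorem diagSum_sub (G H : ℕ → R⟦X⟧) :
    diagSum (fun n => G n - H n) = diagSum G - diagSum H := by
  ext l
  simp [coeff_diagSum, Finset.sum_sub_distrib]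

theorem diagSum_mul_left (F : R⟦X⟧) (G : ℕ → R⟦X⟧) :
    diagSum (fun n => F * G n) = F * diagSum G := by
  ext l
  simp only [coeff_diagSum, coeff_mul, Finset.mul_sum]
  exact sum_antidiagonal_left_comm l fun a b c => coeff b F * coeff c (G a)

theorem diagSum_succ (G : ℕ → R⟦X⟧) :
    diagSum G = G 0 + X * diagSum fun n => G (n + 1) := by
  ext l
  cases l with
  | zero => simp [coeff_diagSum]
  | succ l =>
    rw [coeff_diagSum, Finset.Nat.sum_antidiagonal_succ, map_add, coeff_succ_X_mul, coeff_diagSum]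

theorem diagSum_C (a : ℕ → R) : diagSum (fun n => C (a n)) = mk a := by
  ext l
  rw [coeff_diagSum, coeff_mk, Finset.sum_eq_single (l, 0)]
  · simp
  · rintro ⟨p, q⟩ hp hne
    have hq : q ≠ 0 := by
      rintro rfl
      exact hne (by simpa using hp)
    simp [coeff_C, hq]
  · simp

end Diagonal

section Fay

open PowerSeries Finset nonZeroDivisors

variable {R : Type*} [CommRing R]

/-- The span of the sequences `T^j U`, for `(T U)_i = σ (U_{i+1})`: the sequences of coefficients
of the products of `U` with operators of nonnegative order. -/
def translates (σ : R ≃+* R) (U : ℤ → R) : Submodule R (ℤ → R) :=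
  Submodule.span R (Set.range fun (j : ℕ) (i : ℤ) => σ^[j] (U (i + j)))

theorem translate_mem_translates {σ : R ≃+* R} {U v : ℤ → R} (hv : v ∈ translates σ U) :
    (fun i => σ (v (i + 1))) ∈ translates σ U := by
  induction hv using Submodule.span_induction with
  | mem v hv =>
    obtain ⟨j, rfl⟩ := hv
    refine Submodule.subset_span ⟨j + 1, ?_⟩
    funext i
    simp only [Function.iterate_succ_apply']
    push_cast
    rw [show i + ((j : ℤ) + 1) = i + 1 + j by ring]
  | zero => convert (translates σ U).zero_mem using 1; funext i; simp
  | add v w _ _ hv hw => convert (translates σ U).add_mem hv hw using 1; funext i; simp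
  | smul a v _ hv => convert (translates σ U).smul_mem (σ a) hv using 1; funext i; simp

theorem iterate_translate_mem_translates {σ : R ≃+* R} {U v : ℤ → R} (hv : v ∈ translates σ U)
    (j : ℕ) : (fun i => σ^[j] (v (i + j))) ∈ translates σ U := by
  induction j with
  | zero => simpa using hv
  | succ j ih =>
    have := translate_mem_translates ih
    simp only [Function.iterate_succ_apply']
    convert this using 3 with i
    push_cast
    rw [show i + ((j : ℤ) + 1) = i + 1 + j by ring]

/-- An element of `translates σ U` of order at most `1` is a combination of `U` and `T U`: the
leading coefficient of a combination of the `T^j U` is `σ^j (U_0)` times the last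
coefficient of the combination. -/
theorem exists_eq_of_mem_translates {σ : R ≃+* R} {U v : ℤ → R} (hU : ∀ i < 0, U i = 0)
    (hU0 : U 0 ∈ R⁰) (hv : v ∈ translates σ U) (hv0 : ∀ i < -1, v i = 0) :
    ∃ p q : R, ∀ i, v i = p * U i + q * σ (U (i + 1)) := by
  obtain ⟨c, rfl⟩ := Finsupp.mem_span_range_iff_exists_finsupp.1 hv
  have hval : ∀ i, (c.sum fun j a => a • fun i : ℤ => σ^[j] (U (i + j))) i =
      ∑ j ∈ c.support, c j * σ^[j] (U (i + j)) := by
    intro i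
    simp [Finsupp.sum, Finset.sum_apply]
  have hzero : ∀ j, σ^[j] 0 = 0 := fun j => by
    induction j with
    | zero => rfl
    | succ j ih => rw [Function.iterate_succ_apply', ih, map_zero]
  have hnzd : ∀ j, σ^[j] (U 0) ∈ R⁰ := fun j => by
    induction j with
    | zero => exact hU0
    | succ j ih =>
      rw [Function.iterate_succ_apply', ← MulEquivClass.map_nonZeroDivisors σ]
      exact ⟨_, ih, rfl⟩
  -- If the largest `J` with `c J ≠ 0` is at least `2`, the value at `-J` is `c J * σ^J (U 0)`.
  have hsupp : c.support ⊆ range 2 := by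
    intro j₀ hj₀
    by_contra hlt
    obtain ⟨J, hJ, hmax⟩ := c.support.exists_max_image id ⟨j₀, hj₀⟩
    have hJ2 : 2 ≤ J := le_trans (not_lt.1 fun hj => hlt (mem_range.2 hj)) (hmax j₀ hj₀)
    have h0 := hval (-(J : ℤ))
    rw [hv0 _ (by omega), Finset.sum_eq_single J] at h0
    · rw [neg_add_cancel] at h0
      exact Finsupp.mem_support_iff.1 hJ
        ((mem_nonZeroDivisors_iff_right.1 (hnzd J)) _ h0.symm)
    · intro j hj hne
      have : j < J := lt_of_le_of_ne (hmax j hj) hne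
      rw [hU _ (by omega), hzero, mul_zero]
    · exact fun h => absurd hJ h
  refine ⟨c 0, c 1, fun i => ?_⟩
  rw [hval, Finset.sum_subset hsupp fun j _ hj => by
    rw [Finsupp.notMem_support_iff.1 hj, zero_mul]]
  simp [Finset.sum_range_succ]

theorem coeff_map_iterate (σ : R ≃+* R) (j i : ℕ) (F : R⟦X⟧) :
    coeff i ((PowerSeries.map (σ : R →+* R))^[j] F) = σ^[j] (coeff i F) := by
  induction j with
  | zero => rfl
  | succ j ih => simp only [Function.iterate_succ_apply', coeff_map, ih, RingEquiv.coe_toRingHom]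

theorem map_iterate_sub_X_mul (σ : R ≃+* R) (j : ℕ) (F G : R⟦X⟧) :
    (PowerSeries.map (σ : R →+* R))^[j] (F - X * G) =
      (PowerSeries.map (σ : R →+* R))^[j] F - X * (PowerSeries.map (σ : R →+* R))^[j] G := by
  induction j with
  | zero => rfl
  | succ j ih =>
    simp only [Function.iterate_succ_apply', ih, _root_.map_sub, _root_.map_mul, map_X]

variable [Algebra ℂ R]

/-- The sequence `U` of coefficients of a dressing operator satisfies
`δ_n U = U Λ^(n+1) - B_n U` for operators `B_n = ∑_j b_{n,j} T^j`, where `T` is the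
twisted translation `(T U)_i = σ (U_{i+1})`. Here `δ_n` stands for the derivative with respect to
the time of index `n + 1`, and `N n` bounds the order of `B_n`. -/
structure IsDressing (δ : ℕ → Derivation ℂ R R) (σ : R ≃+* R) (U : ℤ → R) (N : ℕ → ℕ)
    (b : ℕ → ℕ → R) : Prop where
  of_neg : ∀ i < 0, U i = 0
  flow : ∀ n i, δ n (U i) = U (i + 1 + n) - ∑ j ∈ range (N n), b n j * σ^[j] (U (i + j))

namespace IsDressing

variable {δ : ℕ → Derivation ℂ R R} {M : R → R⟦X⟧} {σ : R ≃+* R} {U : ℤ → R} {N : ℕ → ℕ}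
  {b : ℕ → ℕ → R}

theorem map_iterate (h : IsFlow δ M) (hσ : ∀ n f, σ (δ n f) = δ n (σ f)) (j : ℕ) (f : R) :
    M (σ^[j] f) = (PowerSeries.map (σ : R →+* R))^[j] (M f) := by
  induction j with
  | zero => rfl
  | succ j ih =>
    rw [Function.iterate_succ_apply', Function.iterate_succ_apply', ← ih]
    exact h.map_ringHom (σ : R →+* R) hσ _

/-- The differential equation in `y` of `M_y (U) (1 - y Λ)`: the terms `U Λ^(n+1)` of the flow
cancel by a geometric series. -/
theorem derivative_apply (hU : IsDressing δ σ U N b) (h : IsFlow δ M)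
    (hδ : ∀ a b f, δ a (δ b f) = δ b (δ a f)) (hσ : ∀ n f, σ (δ n f) = δ n (σ f)) (i : ℤ) :
    d⁄dX R (M (U i) - X * M (U (i + 1))) = -diagSum fun n => ∑ j ∈ range (N n),
      M (b n j) * (PowerSeries.map (σ : R →+* R))^[j]
        (M (U (i + j)) - X * M (U (i + j + 1))) := by
  set H : ℤ → ℕ → R⟦X⟧ := fun i n => ∑ j ∈ range (N n),
    M (b n j) * (PowerSeries.map (σ : R →+* R))^[j] (M (U (i + j))) with hH
  have hMδ : ∀ i n, M (δ n (U i)) = M (U (i + 1 + n)) - H i n := by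
    intro i n
    have e : ∀ f, h.toRingHom f = M f := fun f => rfl
    rw [hU.flow, hH, ← e, _root_.map_sub, map_sum]
    simp only [e, h.map_mul, map_iterate h hσ]
  have hd : ∀ i, d⁄dX R (M (U i)) = diagSum (fun n => M (U (i + 1 + n))) - diagSum (H i) := by
    intro i
    rw [h.derivative_apply, ← diagSum_sub]
    ext l
    rw [coeff_evol, coeff_diagSum]
    refine Finset.sum_congr rfl fun p _ => ?_
    rw [← hMδ, h.coeff_apply_derivation hδ]
  have hs : diagSum (fun n : ℕ => M (U (i + 1 + n))) =
      M (U (i + 1)) + X * diagSum fun n : ℕ => M (U (i + 1 + 1 + n)) := by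
    rw [diagSum_succ]
    push_cast
    simp only [add_zero, show ∀ n : ℕ, i + 1 + ((n : ℤ) + 1) = i + 1 + 1 + n by intro n; ring]
  have hR : (diagSum fun n => ∑ j ∈ range (N n), M (b n j) *
      (PowerSeries.map (σ : R →+* R))^[j] (M (U (i + j)) - X * M (U (i + j + 1)))) =
      diagSum (H i) - X * diagSum (H (i + 1)) := by
    rw [← diagSum_mul_left, ← diagSum_sub]
    congr 1
    funext n
    simp only [hH, Finset.mul_sum, ← Finset.sum_sub_distrib]
    refine Finset.sum_congr rfl fun j _ => ?_
    rw [map_iterate_sub_X_mul, show i + (j : ℤ) + 1 = i + 1 + j by ring]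
    ring
  rw [hR, _root_.map_sub, Derivation.leibniz, hd, hd, hs, derivative_X]
  simp only [smul_eq_mul, mul_one]
  ring

/-- The coefficients of `M_y (U) (1 - y Λ)` are products of `U` with operators of nonnegative
order. -/
theorem coeff_mem_translates (hU : IsDressing δ σ U N b) (h : IsFlow δ M)
    (hδ : ∀ a b f, δ a (δ b f) = δ b (δ a f)) (hσ : ∀ n f, σ (δ n f) = δ n (σ f)) (l : ℕ) :
    (fun i => coeff l (M (U i) - X * M (U (i + 1)))) ∈ translates σ U := by
  induction l using Nat.strong_induction_on with
  | _ l ih =>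
    cases l with
    | zero =>
      refine Submodule.subset_span ⟨0, ?_⟩
      funext i
      simp [h.constantCoeff_apply]
    | succ l =>
      have hmem : (fun i => coeff l (d⁄dX R (M (U i) - X * M (U (i + 1))))) ∈
          translates σ U := by
        have e : (fun i => coeff l (d⁄dX R (M (U i) - X * M (U (i + 1))))) =
            -∑ p ∈ antidiagonal l, ∑ j ∈ range (N p.1), ∑ q ∈ antidiagonal p.2,
              coeff q.1 (M (b p.1 j)) •
                fun i : ℤ => σ^[j] (coeff q.2 (M (U (i + j)) - X * M (U (i + j + 1)))) := by
          funext i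
          rw [hU.derivative_apply h hδ hσ, map_neg, coeff_diagSum]
          simp only [map_sum, coeff_mul, coeff_map_iterate, Pi.neg_apply, Finset.sum_apply,
            Pi.smul_apply, smul_eq_mul]
        rw [e]
        refine (translates σ U).neg_mem (Submodule.sum_mem _ fun p hp =>
          Submodule.sum_mem _ fun j _ => Submodule.sum_mem _ fun q hq =>
            Submodule.smul_mem _ _ ?_)
        refine iterate_translate_mem_translates
          (v := fun i => coeff q.2 (M (U i) - X * M (U (i + 1)))) (ih q.2 ?_) j
        have h1 := mem_antidiagonal.1 hp
        have h2 := mem_antidiagonal.1 hq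
        omega
      have h0 : ((l : ℂ) + 1) ≠ 0 := by exact_mod_cast l.succ_ne_zero
      convert (translates σ U).smul_mem (algebraMap ℂ R ((l : ℂ) + 1)⁻¹) hmem using 1
      funext i
      have h1 : ((l : R) + 1) = algebraMap ℂ R ((l : ℂ) + 1) := by simp
      rw [Pi.smul_apply, smul_eq_mul, coeff_derivative, h1, mul_left_comm, ← _root_.map_mul,
        inv_mul_cancel₀ h0, _root_.map_one, mul_one]

/-- The auxiliary linear equation `M_y (U) (1 - y Λ) = (P + Q T) U`: the left side has order at most
one, and it is the product of `U` with an operator of nonnegative order. -/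
theorem exists_linear_relation (hU : IsDressing δ σ U N b) (h : IsFlow δ M)
    (hδ : ∀ a b f, δ a (δ b f) = δ b (δ a f)) (hσ : ∀ n f, σ (δ n f) = δ n (σ f))
    (hU0 : U 0 ∈ R⁰) :
    ∃ P Q : R⟦X⟧, ∀ i, M (U i) - X * M (U (i + 1)) = P * C (U i) + Q * C (σ (U (i + 1))) := by
  have hM0 : M 0 = 0 := _root_.map_zero h.toRingHom
  choose p q hpq using fun l =>
    exists_eq_of_mem_translates hU.of_neg hU0 (hU.coeff_mem_translates h hδ hσ l) fun i hi => by
      rw [hU.of_neg i (by omega), hU.of_neg (i + 1) (by omega), hM0, mul_zero, sub_zero,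
        _root_.map_zero]
  refine ⟨PowerSeries.mk p, PowerSeries.mk q, fun i => ?_⟩
  ext l
  rw [hpq, _root_.map_add, coeff_mul_C, coeff_mul_C, coeff_mk, coeff_mk]

/-- The Fay identity for `U_i = (M ρ)_i / τ`, as an identity of power series in `y' = X` with
coefficients in power series in `y`. Elimination of `P` and `Q` from the linear relation
is possible because the left side of its generating function in `y'` vanishes at `y' = y`. -/
theorem fay (hU : IsDressing δ σ U N b) (h : IsFlow δ M)
    (hδ : ∀ a b f, δ a (δ b f) = δ b (δ a f)) (hσ : ∀ n f, σ (δ n f) = δ n (σ f))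
    {ρ τ : R} (hρ : ρ ∈ R⁰) (hτ : ∀ i : ℕ, τ * U i = coeff i (M ρ)) :
    ((X : R⟦X⟧⟦X⟧) - C X) * C (C (σ ρ)) * PowerSeries.map h.toRingHom (M ρ) =
      X * PowerSeries.map C (M ρ) * C (M (σ ρ)) -
        C X * C (M ρ) * PowerSeries.map C (M (σ ρ)) := by
  have hτ0 : τ * U 0 = ρ := by
    simpa [h.constantCoeff_apply] using hτ 0
  have hU0 : U 0 ∈ R⁰ := (mul_mem_nonZeroDivisors.1 (hτ0 ▸ hρ)).2
  obtain ⟨P, Q, hPQ⟩ := hU.exists_linear_relation h hδ hσ hU0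
  have hM0 : M 0 = 0 := _root_.map_zero h.toRingHom
  have hU1 : U (-1) = 0 := hU.of_neg _ (by norm_num)
  set u : R⟦X⟧ := PowerSeries.mk fun i : ℕ => U i with hu
  set s : R⟦X⟧ := PowerSeries.map (σ : R →+* R) u with hs
  have hs' : s = PowerSeries.mk fun i : ℕ => σ (U i) := by
    ext i
    simp [hs, hu]
  have hboundary : -(X * M (U 0)) = Q * C (σ (U 0)) := by
    have := hPQ (-1)
    rw [neg_add_cancel, hU1, hM0, _root_.map_zero] at this
    linear_combination this
  have hgen : ((X : R⟦X⟧⟦X⟧) - C X) * PowerSeries.map h.toRingHom u =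
      C P * (X * PowerSeries.map C u) + C Q * PowerSeries.map C s := by
    refine PowerSeries.ext fun n => ?_
    rw [sub_mul, _root_.map_sub, _root_.map_add, coeff_C_mul, coeff_C_mul, coeff_C_mul, coeff_map,
      coeff_map, hs', coeff_mk]
    cases n with
    | zero => simpa [hu] using hboundary
    | succ n =>
      rw [coeff_succ_X_mul, coeff_succ_X_mul, coeff_map, coeff_map, hu, coeff_mk, coeff_mk]
      simpa using hPQ n
  -- The value of `hgen` at `y' = y`.
  have hdiag : X * P * u + Q * s = 0 := by
    have e1 : diagSum (fun n : ℕ => M (U n)) =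
        M (U 0) + X * diagSum fun n : ℕ => M (U (n + 1)) := by
      rw [diagSum_succ]
      push_cast
      rfl
    have e2 : diagSum (fun n : ℕ => C (σ (U n))) =
        C (σ (U 0)) + X * diagSum fun n : ℕ => C (σ (U (n + 1))) := by
      rw [diagSum_succ]
      push_cast
      rfl
    have e3 : diagSum (fun n : ℕ => M (U n)) - X * diagSum (fun n : ℕ => M (U (n + 1))) =
        P * diagSum (fun n : ℕ => C (U n)) + Q * diagSum fun n : ℕ => C (σ (U (n + 1))) := by
      simp only [← diagSum_mul_left, ← diagSum_sub, ← diagSum_add]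
      congr 1
      funext n
      exact hPQ n
    rw [hs', hu, ← diagSum_C, ← diagSum_C, e2]
    rw [e1] at e3
    linear_combination (-X) * e3 - hboundary
  have hMρ : C τ * u = M ρ := by
    ext i
    rw [coeff_C_mul, hu, coeff_mk, hτ]
  have hMσρ : C (σ τ) * s = M (σ ρ) := by
    have := h.map_ringHom (σ : R →+* R) hσ ρ
    rw [RingEquiv.coe_toRingHom] at this
    rw [this, ← hMρ, hs, _root_.map_mul, map_C]
    rfl
  have hMM : C (M τ) * PowerSeries.map h.toRingHom u = PowerSeries.map h.toRingHom (M ρ) := by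
    rw [← hMρ, _root_.map_mul, map_C]
    rfl
  have hM'ρ : C (C τ) * PowerSeries.map C u = PowerSeries.map C (M ρ) := by
    rw [← hMρ, _root_.map_mul, map_C]
  have hM'σρ : C (C (σ τ)) * PowerSeries.map C s = PowerSeries.map C (M (σ ρ)) := by
    rw [← hMσρ, _root_.map_mul, map_C]
  have hMτ0 : M τ * M (U 0) = M ρ := by rw [← h.map_mul, hτ0]
  have hσρ : C (σ τ) * C (σ (U 0)) = C (σ ρ) := by rw [← _root_.map_mul, ← _root_.map_mul, hτ0]
  have hreg : C (X * M ρ) ∈ (R⟦X⟧⟦X⟧)⁰ := by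
    refine MvPowerSeries.mem_nonZeroDivisors_of_constantCoeff ?_
    change constantCoeff (C (X * M ρ)) ∈ _
    rw [constantCoeff_C]
    refine mul_mem MvPowerSeries.X_mem_nonzeroDivisors
      (MvPowerSeries.mem_nonZeroDivisors_of_constantCoeff ?_)
    change constantCoeff (M ρ) ∈ _
    rwa [h.constantCoeff_apply]
  -- By `hdiag`, `P = -Q s / (y u)` with `u = M ρ / τ`; hence the factors `y` and `M ρ`.
  refine (mul_cancel_left_mem_nonZeroDivisors hreg).1 ?_
  set z : R⟦X⟧⟦X⟧ := X
  set y : R⟦X⟧⟦X⟧ := C X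
  set a : R⟦X⟧⟦X⟧ := C (C (σ (U 0)))
  set t : R⟦X⟧⟦X⟧ := C (C τ)
  set st : R⟦X⟧⟦X⟧ := C (C (σ τ))
  set mt : R⟦X⟧⟦X⟧ := C (M τ)
  set r : R⟦X⟧⟦X⟧ := C (M ρ)
  set p : R⟦X⟧⟦X⟧ := C P
  set sy : R⟦X⟧⟦X⟧ := C s
  set u' := PowerSeries.map C u
  set s' := PowerSeries.map C s
  have cb := congrArg (C (R := R⟦X⟧)) hboundary
  have cd := congrArg (C (R := R⟦X⟧)) hdiag
  have c1 := congrArg (C (R := R⟦X⟧)) hMρ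
  have c2 := congrArg (C (R := R⟦X⟧)) hMσρ
  have c3 := congrArg (C (R := R⟦X⟧)) hMτ0
  have c4 := congrArg (C (R := R⟦X⟧)) hσρ
  simp only [_root_.map_mul, _root_.map_add, _root_.map_neg, _root_.map_zero] at cb cd c1 c2 c3 c4 ⊢
  rw [← hMM, ← hM'ρ, ← hM'σρ, ← c2, ← c4]
  linear_combination
    (y * r * st * a * mt) * hgen - (y * st * z * u' * a * mt * p) * c1 +
    (st * z * u' * a * mt * t) * cd + (st * z * u' * mt * t * sy - y * r * st * mt * s') * cb +
    (st * z * u' * t * sy * y - y * r * st * s' * y) * c3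

end IsDressing

end Fay

/-! ### Translations and partial derivatives of functions -/

section Functions

open Finset

variable {𝕜 : Type*} [RCLike 𝕜] {D : ShiftDomain 𝕜} {m : ℕ+}

/-- The ring homomorphism `g ↦ g (· + i)` on functions of `s`. -/
def translateHom (D : ShiftDomain 𝕜) (i : ℤ) : (D.carrier → ℂ) →+* (D.carrier → ℂ) where
  toFun g s := g ⟨(s : 𝕜) + (i : 𝕜), D.add_int_mem s.2 i⟩
  map_one' := rfl
  map_mul' _ _ := rfl
  map_zero' := rfl
  map_add' _ _ := rfl

theorem shift_eq_map (i : ℤ) (f : Fn D m) :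
    shift i f = MvPowerSeries.map (translateHom D i) f := rfl

theorem coeff_shift (i : ℤ) (f : Fn D m) (α : TimeVar m →₀ ℕ) (s : D.carrier) :
    MvPowerSeries.coeff α (shift i f) s =
      MvPowerSeries.coeff α f ⟨(s : 𝕜) + (i : 𝕜), D.add_int_mem s.2 i⟩ := rfl

theorem shift_zero (f : Fn D m) : shift 0 f = f := by
  refine MvPowerSeries.ext fun α => funext fun s => ?_
  exact congrArg (MvPowerSeries.coeff α f) (Subtype.ext (by simp))

theorem shift_shift (i j : ℤ) (f : Fn D m) : shift i (shift j f) = shift (i + j) f := by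
  refine MvPowerSeries.ext fun α => funext fun s => ?_
  exact congrArg (MvPowerSeries.coeff α f) (Subtype.ext (by push_cast; ring))

/-- `shift i` as a ring automorphism. -/
def shiftEquiv (D : ShiftDomain 𝕜) (m : ℕ+) (i : ℤ) : Fn D m ≃+* Fn D m where
  toFun := shift i
  invFun := shift (-i)
  left_inv f := by rw [shift_shift, neg_add_cancel, shift_zero]
  right_inv f := by rw [shift_shift, add_neg_cancel, shift_zero]
  map_mul' f g := by simp only [shift_eq_map, map_mul]
  map_add' f g := by simp only [shift_eq_map, map_add]

@[simp] theorem shiftEquiv_apply (i : ℤ) (f : Fn D m) : shiftEquiv D m i f = shift i f := rfl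

theorem iterate_shiftEquiv (i : ℤ) (j : ℕ) (f : Fn D m) :
    (shiftEquiv D m i)^[j] f = shift (j * i) f := by
  induction j with
  | zero => simp [shift_zero]
  | succ j ih =>
    rw [Function.iterate_succ_apply', ih, shiftEquiv_apply, shift_shift]
    congr 1
    push_cast
    ring

theorem shift_dVar (i : ℤ) (v : TimeVar m) (f : Fn D m) :
    shift i (dVar v f) = dVar v (shift i f) := by
  refine MvPowerSeries.ext fun α => funext fun s => ?_
  rw [coeff_shift, dVar, dVar, MvPowerSeries.coeff_pderiv, MvPowerSeries.coeff_pderiv]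
  rfl

theorem dVar_comm (v w : TimeVar m) (f : Fn D m) : dVar v (dVar w f) = dVar w (dVar v f) := by
  refine MvPowerSeries.ext fun α => ?_
  simp only [dVar, MvPowerSeries.coeff_pderiv]
  rw [add_right_comm]
  by_cases h : v = w
  · rw [h]
  · simp only [Finsupp.add_apply, Finsupp.single_eq_of_ne h, Finsupp.single_eq_of_ne (Ne.symm h),
      add_zero]
    ring

/-- The derivations `c ∂/∂v_(n+1)`, `n ≥ 0`. -/
noncomputable def timeDer (D : ShiftDomain 𝕜) (c : ℂ) (v : ℕ+ → TimeVar m) (n : ℕ) :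
    Derivation ℂ (Fn D m) (Fn D m) :=
  c • (MvPowerSeries.pderiv (D.carrier → ℂ) (v n.succPNat)).restrictScalars ℂ

theorem timeDer_apply (c : ℂ) (v : ℕ+ → TimeVar m) (n : ℕ) (f : Fn D m) :
    timeDer D c v n f = c • dVar (v n.succPNat) f := rfl

theorem dVar_smul (c : ℂ) (v : TimeVar m) (f : Fn D m) : dVar v (c • f) = c • dVar v f :=
  ((MvPowerSeries.pderiv (D.carrier → ℂ) v).restrictScalars ℂ).map_smul c f

theorem timeDer_comm (c : ℂ) (v : ℕ+ → TimeVar m) (a b : ℕ) (f : Fn D m) :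
    timeDer D c v a (timeDer D c v b f) = timeDer D c v b (timeDer D c v a f) := by
  simp only [timeDer_apply, dVar_smul, dVar_comm (v a.succPNat)]

theorem shift_smul (i : ℤ) (c : ℂ) (f : Fn D m) : shift i (c • f) = c • shift i f := rfl

theorem shift_timeDer (i : ℤ) (c : ℂ) (v : ℕ+ → TimeVar m) (n : ℕ) (f : Fn D m) :
    shiftEquiv D m i (timeDer D c v n f) = timeDer D c v n (shiftEquiv D m i f) := by
  simp only [timeDer_apply, shiftEquiv_apply, shift_smul, shift_dVar]

theorem miwaGen_eq_coeff (c : ℂ) (v : ℕ+ → TimeVar m) (F : PowerSeries (Fn D m)) (i : ℕ) :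
    miwaGen c (fun n => dVar (v n)) (fun l => PowerSeries.coeff l F) i =
      PowerSeries.coeff i (expGen (timeDer D c v) F) := by
  cases i with
  | zero => simp [miwaGen, expGen]
  | succ i =>
    rw [expGen, PowerSeries.coeff_succ_X_mul, coeff_evol,
      Finset.Nat.sum_antidiagonal_eq_sum_range_succ
        (fun a b => integrated (timeDer D c v) a (PowerSeries.coeff b F)), miwaGen]
    refine Finset.sum_congr rfl fun n _ => ?_
    rw [integrated, Derivation.smul_apply, timeDer_apply, smul_smul, Nat.add_sub_add_right]
    congr 1
    ring

/-- The power series of the shift of `f` by `[y]` in the times `v_n`. -/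
noncomputable def miwaSeries (c : ℂ) (v : ℕ+ → TimeVar m) (f : Fn D m) : PowerSeries (Fn D m) :=
  PowerSeries.mk (miwa c (fun n => dVar (v n)) f)

theorem coeff_miwaSeries (c : ℂ) (v : ℕ+ → TimeVar m) (f : Fn D m) (i : ℕ) :
    PowerSeries.coeff i (miwaSeries c v f) = miwa c (fun n => dVar (v n)) f i :=
  PowerSeries.coeff_mk _ _

theorem isFlow_miwaSeries (D : ShiftDomain 𝕜) (c : ℂ) (v : ℕ+ → TimeVar m) :
    IsFlow (timeDer D c v) (miwaSeries c v) := by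
  have h : ∀ (f : Fn D m) (j : ℕ), (miwaGen c (fun n => dVar (v n)))^[j]
      (fun l => if l = 0 then f else 0) =
      fun i => PowerSeries.coeff i ((expGen (timeDer D c v))^[j] (PowerSeries.C f)) := by
    intro f j
    induction j with
    | zero =>
      funext i
      simp [PowerSeries.coeff_C]
    | succ j ih =>
      funext i
      rw [Function.iterate_succ_apply', ih, miwaGen_eq_coeff, Function.iterate_succ_apply']
  convert isFlow_exp (timeDer_comm (D := D) c v) using 1
  funext f
  ext1 i
  rw [coeff_miwaSeries, PowerSeries.coeff_mk, miwa]
  simp only [h]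

theorem shift_miwa (i : ℤ) (c : ℂ) (v : ℕ+ → TimeVar m) (f : Fn D m) (n : ℕ) :
    shift i (miwa c (fun n => dVar (v n)) f n) = miwa c (fun n => dVar (v n)) (shift i f) n := by
  have := congrArg (PowerSeries.coeff n) ((isFlow_miwaSeries D c v).map_ringHom
    (shiftEquiv D m i : Fn D m →+* Fn D m) (shift_timeDer i c v) f)
  rw [PowerSeries.coeff_map, coeff_miwaSeries, coeff_miwaSeries] at this
  exact this.symm

theorem miwa_zero_right (c : ℂ) (v : ℕ+ → TimeVar m) (f : Fn D m) :
    miwa c (fun n => dVar (v n)) f 0 = f := by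
  rw [← coeff_miwaSeries, PowerSeries.coeff_zero_eq_constantCoeff_apply,
    (isFlow_miwaSeries D c v).constantCoeff_apply]

/-- A function that vanishes for no `s` is not a zero divisor: for every `s`, formal power series
with complex coefficients form a domain. -/
theorem mem_nonZeroDivisors_of_evalS_ne_zero {f : Fn D m} (hf : ∀ s, evalS s f ≠ 0) :
    f ∈ nonZeroDivisors (Fn D m) := by
  rw [mem_nonZeroDivisors_iff_right]
  intro g hg
  have h : ∀ s, evalS s g = 0 := fun s => by
    have := congrArg (evalS s) hg
    simp only [evalS, map_mul, map_zero] at this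
    exact (mul_eq_zero.1 this).resolve_right (hf s)
  refine MvPowerSeries.ext fun α => funext fun s => ?_
  simpa [evalS] using congrArg (MvPowerSeries.coeff α) (h s)

end Functions

/-! ### Products of difference operators -/

namespace DiffOp

variable {𝕜 : Type*} [RCLike 𝕜] {D : ShiftDomain 𝕜} {m : ℕ+}

theorem shift_map_zero (i : ℤ) : shift i (0 : Fn D m) = 0 := rfl

theorem shift_map_one (i : ℤ) : shift i (1 : Fn D m) = 1 := map_one (shiftEquiv D m i)

theorem shift_map_mul (i : ℤ) (f g : Fn D m) : shift i (f * g) = shift i f * shift i g :=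
  map_mul (shiftEquiv D m i) f g

theorem mul_lam (A : DiffOp D m) (n : ℤ) : mul A (lam n) = fun j => A (j - n) := by
  funext j
  rw [mul, finsum_eq_single _ (j - n)]
  · simp [lam, shift_map_one]
  · intro i hi
    have : (lam n : DiffOp D m) (j - i) = 0 := Pi.single_eq_of_ne (by omega) _
    rw [this, shift_map_zero, mul_zero]

/-- Associativity, if only finitely many triples of terms contribute to each coefficient. -/
theorem mul_assoc_of_finite {A B C : DiffOp D m}
    (h : ∀ j, {p : ℤ × ℤ | A p.1 ≠ 0 ∧ B p.2 ≠ 0 ∧ C (j - p.1 - p.2) ≠ 0}.Finite) :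
    mul (mul A B) C = mul A (mul B C) := by
  funext j
  set f : ℤ × ℤ → Fn D m := fun p =>
    A p.1 * shift p.1 (B p.2) * shift (p.1 + p.2) (C (j - p.1 - p.2)) with hf
  have hne : ∀ p, f p ≠ 0 → p ∈ {p : ℤ × ℤ | A p.1 ≠ 0 ∧ B p.2 ≠ 0 ∧ C (j - p.1 - p.2) ≠ 0} := by
    intro p hp
    refine ⟨fun h0 => hp ?_, fun h0 => hp ?_, fun h0 => hp ?_⟩ <;> simp [hf, h0, shift_map_zero]
  have hfs : Function.HasFiniteSupport f := (h j).subset hne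
  let e : ℤ × ℤ ≃ ℤ × ℤ :=
    { toFun := fun p => (p.2, p.1 - p.2)
      invFun := fun p => (p.1 + p.2, p.1)
      left_inv := fun p => by simp
      right_inv := fun p => by simp }
  have hfe : Function.HasFiniteSupport fun p => f (e p) := hfs.preimage e.injective.injOn
  have h1 : mul (mul A B) C j = ∑ᶠ p, f (e p) := by
    rw [finsum_curry _ hfe, mul]
    refine finsum_congr fun i => ?_
    by_cases hC : C (j - i) = 0
    · simp [hf, e, hC, shift_map_zero]
    · rw [mul, finsum_mul']
      · refine finsum_congr fun l => ?_
        simp only [hf, e, Equiv.coe_fn_mk]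
        rw [show l + (i - l) = i by ring, show j - l - (i - l) = j - i by ring]
      · have hinj : Function.Injective fun l : ℤ => ((l, i - l) : ℤ × ℤ) := fun a b hab =>
          congrArg Prod.fst hab
        refine ((h j).preimage hinj.injOn).subset fun l hl => ⟨fun h0 => hl ?_, fun h0 => hl ?_, ?_⟩
        · simp [h0]
        · simp [h0, shift_map_zero]
        · change C (j - l - (i - l)) ≠ 0
          rwa [show j - l - (i - l) = j - i by ring]
  have h2 : mul A (mul B C) j = ∑ᶠ p, f p := by
    rw [finsum_curry _ hfs, mul]
    refine finsum_congr fun l => ?_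
    by_cases hA : A l = 0
    · simp [hf, hA]
    · have hinj : Function.Injective fun q : ℤ => ((l, q) : ℤ × ℤ) := fun a b hab =>
        congrArg Prod.snd hab
      have hs : Function.HasFiniteSupport fun q => B q * shift q (C (j - l - q)) := by
        refine ((h j).preimage hinj.injOn).subset fun q hq => ⟨hA, fun h0 => hq ?_, fun h0 => hq ?_⟩
        · simp [h0]
        · simp [h0, shift_map_zero]
      have hs' : Function.HasFiniteSupport fun q => shift l (B q * shift q (C (j - l - q))) := by
        refine hs.subset fun q hq h0 => hq ?_
        simp only [h0, shift_map_zero]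
      have e1 : shift l (mul B C (j - l)) = ∑ᶠ q, shift l (B q * shift q (C (j - l - q))) :=
        (shiftEquiv D m l : Fn D m →+ Fn D m).map_finsum hs
      rw [e1, mul_finsum' _ _ hs']
      refine finsum_congr fun q => ?_
      rw [shift_map_mul, shift_shift]
      exact (mul_assoc _ _ _).symm
  rw [h1, h2, finsum_comp_equiv e]

theorem mul_eq_zero_of_forall {A B : DiffOp D m} {j : ℤ}
    (h : ∀ i, A i = 0 ∨ B (j - i) = 0) : mul A B j = 0 := by
  rw [mul, finsum_eq_zero_of_forall_eq_zero]
  intro i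
  rcases h i with h | h <;> simp [h, shift_map_zero]

theorem plus_add_minus (A : DiffOp D m) (i : ℤ) : plus A i + minus A i = A i := by
  by_cases h : 0 ≤ i
  · simp [plus, minus, h]
  · simp [plus, minus, h, not_le.1 h]

theorem plus_mul_add_minus_mul {A B : DiffOp D m} {j : ℤ}
    (h : {i : ℤ | A i ≠ 0 ∧ B (j - i) ≠ 0}.Finite) :
    mul (plus A) B j + mul (minus A) B j = mul A B j := by
  rw [mul, mul, mul, ← finsum_add_distrib]
  · refine finsum_congr fun i => ?_
    rw [← add_mul, plus_add_minus]
  · refine h.subset fun i hi => ⟨fun h0 => hi ?_, fun h0 => hi ?_⟩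
    · simp [plus, h0]
    · simp [h0, shift_map_zero]
  · refine h.subset fun i hi => ⟨fun h0 => hi ?_, fun h0 => hi ?_⟩
    · simp [minus, h0]
    · simp [h0, shift_map_zero]

/-- The product with an operator in the powers `Λ^(e q)`, `q < N`, as a finite sum. -/
theorem mul_eq_sum {A B : DiffOp D m} {N : ℕ} {e : ℕ → ℤ} (he : Function.Injective e)
    (hA : ∀ i, A i ≠ 0 → ∃ q < N, e q = i) (j : ℤ) :
    mul A B j = ∑ q ∈ Finset.range N, A (e q) * shift (e q) (B (j - e q)) := by
  rw [mul, finsum_eq_sum_of_support_subset (s := (Finset.range N).map ⟨e, he⟩), Finset.sum_map]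
  · rfl
  · intro i hi
    obtain ⟨q, hq, rfl⟩ := hA i fun h0 => hi (by simp [h0])
    simpa using ⟨q, hq, rfl⟩

end DiffOp

/-! ### The wave operators as dressings -/

namespace WaveOps

open DiffOp

variable {𝕜 : Type*} [RCLike 𝕜] [NormedSpace 𝕜 ℂ] {D : ShiftDomain 𝕜} {m : ℕ+}
  (P : WaveOps D m)

theorem fracPow_eq_zero (n : ℕ) {i : ℤ} (hi : (n : ℤ) < i) : P.fracPow n i = 0 := by
  rw [fracPow, mul_lam]
  refine mul_eq_zero_of_forall fun l => ?_
  by_cases hl : 0 < l - n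
  · exact Or.inl (P.W_pos _ hl)
  · exact Or.inr (P.Winv_pos _ (by omega))

theorem fracPowBar_eq_zero (n : ℕ) {i : ℤ} (hi : i < -(n : ℤ)) : P.fracPowBar n i = 0 := by
  rw [fracPowBar, mul_lam]
  refine mul_eq_zero_of_forall fun l => ?_
  by_cases hl : l - -(n : ℤ) < 0
  · exact Or.inl (P.Wbar_neg _ hl)
  · exact Or.inr (P.Wbarinv_neg _ (by omega))

/-- `L^(n/k) W = W Λ^n`. -/
theorem fracPow_mul_W (n : ℕ) (j : ℤ) : mul (P.fracPow n) P.W j = P.W (j - n) := by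
  rw [fracPow, mul_assoc_of_finite, P.Winv_mul, mul_lam]
  · simp only [sub_zero, mul_lam]
  intro j
  refine ((Finset.Icc j n ×ˢ Finset.Icc (j - n) 0).finite_toSet).subset ?_
  rintro ⟨a, b⟩ ⟨ha, hb, hc⟩
  rw [mul_lam] at ha
  have h1 : a - n ≤ 0 := not_lt.1 fun h => ha (P.W_pos _ h)
  have h2 : b ≤ 0 := not_lt.1 fun h => hb (P.Winv_pos _ h)
  have h3 : j - a - b ≤ 0 := not_lt.1 fun h => hc (P.W_pos _ h)
  simp only [Finset.coe_product, Finset.coe_Icc, Set.mem_prod, Set.mem_Icc]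
  omega

/-- `L^(n/m) Wbar = Wbar Λ^(-n)`. -/
theorem fracPowBar_mul_Wbar (n : ℕ) (j : ℤ) :
    mul (P.fracPowBar n) P.Wbar j = P.Wbar (j + n) := by
  rw [fracPowBar, mul_assoc_of_finite, P.Wbarinv_mul, mul_lam]
  · simp only [sub_zero, mul_lam, sub_neg_eq_add]
  intro j
  refine ((Finset.Icc (-(n : ℤ)) j ×ˢ Finset.Icc 0 (j + n)).finite_toSet).subset ?_
  rintro ⟨a, b⟩ ⟨ha, hb, hc⟩
  rw [mul_lam] at ha
  have h1 : 0 ≤ a - -(n : ℤ) := not_lt.1 fun h => ha (P.Wbar_neg _ h)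
  have h2 : 0 ≤ b := not_lt.1 fun h => hb (P.Wbarinv_neg _ h)
  have h3 : 0 ≤ j - a - b := not_lt.1 fun h => hc (P.Wbar_neg _ h)
  simp only [Finset.coe_product, Finset.coe_Icc, Set.mem_prod, Set.mem_Icc]
  omega

/-- The flow `∂W/∂t_n = (L^(n/k))_+ W - W Λ^n`, with a finite sum for the product. -/
theorem IsSolution.dT_W {P : WaveOps D m} {k : ℕ+} (hP : P.IsSolution k) (n : ℕ+) (j : ℤ) :
    dT n (P.W j) = ∑ q ∈ Finset.range ((n : ℕ) + 1),
      plus (P.fracPow n) q * shift q (P.W (j - q)) - P.W (j - n) := by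
  have h1 : dT n (P.W j) = -mul (minus (P.fracPow n)) P.W j := congrFun (hP.flow_t_W n) j
  have h2 := plus_mul_add_minus_mul (A := P.fracPow n) (B := P.W) (j := j) (by
    refine (Set.finite_Icc j (n : ℤ)).subset fun i hi => ?_
    have h3 : i ≤ (n : ℤ) := not_lt.1 fun h => hi.1 (P.fracPow_eq_zero _ h)
    have h4 : j - i ≤ 0 := not_lt.1 fun h => hi.2 (P.W_pos _ h)
    exact ⟨by omega, h3⟩)
  rw [P.fracPow_mul_W] at h2
  rw [h1, ← h2, ← mul_eq_sum Nat.cast_injective]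
  · ring
  · intro i hi
    have h3 : 0 ≤ i := not_lt.1 fun h => hi (if_neg (not_le.2 h))
    have h4 : i ≤ (n : ℤ) := not_lt.1 fun h => hi (by simp [plus, P.fracPow_eq_zero _ h])
    exact ⟨i.toNat, by omega, by omega⟩

/-- The flow `∂Wbar/∂tbar_n = Wbar Λ^(-n) - (L^(n/m))_- Wbar`, with a finite sum for the product. -/
theorem IsSolution.dTbar_Wbar {P : WaveOps D m} {k : ℕ+} (hP : P.IsSolution k) (n : ℕ+) (j : ℤ) :
    dTbar k n (P.Wbar j) = P.Wbar (j + n) - ∑ q ∈ Finset.range ((n : ℕ) + 1),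
      minus (P.fracPowBar n) (-q) * shift (-q) (P.Wbar (j + q)) := by
  have h1 : dTbar k n (P.Wbar j) = mul (plus (P.fracPowBar n)) P.Wbar j :=
    congrFun (hP.flow_tbar_Wbar n) j
  have h2 := plus_mul_add_minus_mul (A := P.fracPowBar n) (B := P.Wbar) (j := j) (by
    refine (Set.finite_Icc (-(n : ℤ)) j).subset fun i hi => ?_
    have h3 : -(n : ℤ) ≤ i := not_lt.1 fun h => hi.1 (P.fracPowBar_eq_zero _ h)
    have h4 : 0 ≤ j - i := not_lt.1 fun h => hi.2 (P.Wbar_neg _ h)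
    exact ⟨h3, by omega⟩)
  rw [P.fracPowBar_mul_Wbar] at h2
  have h5 := mul_eq_sum (A := minus (P.fracPowBar n)) (B := P.Wbar) (N := (n : ℕ) + 1)
    (e := fun q => -(q : ℤ)) (neg_injective.comp Nat.cast_injective) (fun i hi => by
      have h3 : i < 0 := not_le.1 fun h => hi (if_neg (not_lt.2 h))
      have h4 : -(n : ℤ) ≤ i :=
        not_lt.1 fun h => hi (by simp [minus, P.fracPowBar_eq_zero _ h])
      exact ⟨i.natAbs, by omega, by omega⟩) j
  simp only [sub_neg_eq_add] at h5
  rw [h1, ← h2, ← h5]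
  ring

/-- The sequence `w_i(s - 1)`; the translation by `-1` makes it the quotient of the shift of
`τ(s - 1)` by `τ(s - 1)`, the function shifted twice in the Fay identity. -/
theorem IsSolution.isDressing_W {P : WaveOps D m} {k : ℕ+} (hP : P.IsSolution k) :
    IsDressing (timeDer D (-1) TimeVar.t) (shiftEquiv D m 1) (fun i => shift (-1) (P.W (-i)))
      (fun n => n + 2) (fun n j => shift (-1) (plus (P.fracPow (n + 1)) j)) where
  of_neg i hi := by
    change shift (-1) (P.W (-i)) = 0
    rw [P.W_pos _ (by omega), shift_map_zero]
  flow n i := by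
    have h := congrArg (shiftEquiv D m (-1)) (hP.dT_W n.succPNat (-i))
    rw [map_sub, map_sum] at h
    simp only [shiftEquiv_apply, shift_map_mul, dT, shift_dVar] at h
    rw [timeDer_apply, h]
    simp only [Nat.succPNat_coe, iterate_shiftEquiv, shift_shift, neg_smul, one_smul, neg_sub]
    congr 1
    · congr 2
      push_cast
      ring
    · refine Finset.sum_congr rfl fun q _ => ?_
      rw [mul_one, add_comm (-1 : ℤ), neg_add']

theorem IsSolution.isDressing_Wbar {P : WaveOps D m} {k : ℕ+} (hP : P.IsSolution k) :
    IsDressing (timeDer D 1 (tbarVar k m)) (shiftEquiv D m (-1)) P.Wbar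
      (fun n => n + 2) (fun n j => minus (P.fracPowBar (n + 1)) (-j)) where
  of_neg i hi := P.Wbar_neg i hi
  flow n i := by
    have h := hP.dTbar_Wbar n.succPNat i
    rw [dTbar] at h
    rw [timeDer_apply, one_smul, h]
    simp only [Nat.succPNat_coe, iterate_shiftEquiv]
    congr 1
    · congr 1
      push_cast
      ring
    · refine Finset.sum_congr rfl fun q _ => ?_
      rw [mul_neg_one]

end WaveOps

/-! ### Coefficients of the Fay identity -/

section Coefficients

/-- The sequence of coefficients of `y ∑ g_n y^n`. -/
def delay {R : Type*} [Zero R] (g : ℕ → R) : ℕ → R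
  | 0 => 0
  | n + 1 => g n

theorem coeff_X_mul_eq_delay {R : Type*} [CommRing R] (F : PowerSeries R) (n : ℕ) :
    PowerSeries.coeff n (PowerSeries.X * F) = delay (fun n => PowerSeries.coeff n F) n := by
  cases n with
  | zero => simp [delay]
  | succ n => rw [PowerSeries.coeff_succ_X_mul, delay]

/-- The Fay identity for shifts with coefficients `E f i`: with parameters `y`, `y'` and the
sums `E_y f = ∑ y^i E f i`, it reads
`(y' - y) τ E_y E_y' ρ = y' E_y τ E_y' ρ - y E_y ρ E_y' τ`, coefficient by coefficient. -/
def FayIdentity {R : Type*} [CommRing R] (E : R → ℕ → R) (ρ τ : R) : Prop :=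
  ∀ a b, τ * (delay (fun j => E (E ρ j) a) b - delay (fun i => E (E ρ b) i) a) =
    E τ a * delay (E ρ) b - delay (E ρ) a * E τ b

theorem IsDressing.fayIdentity {R : Type*} [CommRing R] [Algebra ℂ R]
    {δ : ℕ → Derivation ℂ R R} {M : R → PowerSeries R} {σ : R ≃+* R} {U : ℤ → R} {N : ℕ → ℕ}
    {c : ℕ → ℕ → R} (hU : IsDressing δ σ U N c) (h : IsFlow δ M)
    (hδ : ∀ a b f, δ a (δ b f) = δ b (δ a f)) (hσ : ∀ n f, σ (δ n f) = δ n (σ f))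
    {ρ τ : R} (hρ : ρ ∈ nonZeroDivisors R)
    (hτ : ∀ i : ℕ, τ * U i = PowerSeries.coeff i (M ρ)) :
    FayIdentity (fun f i => PowerSeries.coeff i (M f)) ρ (σ ρ) := by
  intro a b
  have e : PowerSeries.C (PowerSeries.C (σ ρ)) *
      (PowerSeries.X * PowerSeries.map h.toRingHom (M ρ) -
        PowerSeries.C PowerSeries.X * PowerSeries.map h.toRingHom (M ρ)) =
      PowerSeries.C (M (σ ρ)) * (PowerSeries.X * PowerSeries.map PowerSeries.C (M ρ)) -
        PowerSeries.C (PowerSeries.X * M ρ) * PowerSeries.map PowerSeries.C (M (σ ρ)) := by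
    rw [map_mul PowerSeries.C]
    linear_combination hU.fay h hδ hσ hρ hτ
  have key := congrArg (PowerSeries.coeff a) (congrArg (PowerSeries.coeff b) e)
  simp only [map_sub, PowerSeries.coeff_C_mul, coeff_X_mul_eq_delay,
    PowerSeries.coeff_map, IsFlow.toRingHom_apply] at key
  have e1 : PowerSeries.coeff a (delay (fun n => M (PowerSeries.coeff n (M ρ))) b) =
      delay (fun j => PowerSeries.coeff a (M (PowerSeries.coeff j (M ρ)))) b := by
    cases b <;> simp [delay]
  have e2 : delay (fun n => PowerSeries.C (PowerSeries.coeff n (M ρ))) b =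
      PowerSeries.C (delay (fun n => PowerSeries.coeff n (M ρ)) b) := by
    cases b <;> simp [delay]
  rw [e1, e2, PowerSeries.coeff_mul_C, PowerSeries.coeff_mul_C, coeff_X_mul_eq_delay] at key
  exact key

end Coefficients

section Formal

open MvPowerSeries

variable {𝕜 : Type*} [RCLike 𝕜] {D : ShiftDomain 𝕜} {m : ℕ+}

theorem coeff_X_mul_eq_delay_update {R : Type*} [CommRing R] (F : MvPowerSeries (Fin 2) R)
    (n : Fin 2 →₀ ℕ) (i : Fin 2) : coeff n (X i * F) =
      delay (fun a => coeff (n.update i a) F) (n i) := by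
  rw [X, coeff_monomial_mul, one_mul]
  cases h : n i with
  | zero =>
    rw [if_neg, delay]
    intro hle
    simpa [h] using hle i
  | succ a =>
    rw [if_pos (by simp [h]), delay]
    congr 2
    ext j
    by_cases hj : j = i
    · subst hj; simp [h]
    · simp [Function.update_of_ne hj, Finsupp.single_eq_of_ne hj]

theorem coeff_fstSeries_mul_sndSeries (E : Fn D m → ℕ → Fn D m) (f g : Fn D m)
    (n : Fin 2 →₀ ℕ) :
    coeff n (fstSeries E f * sndSeries E g) = E f (n 0) * E g (n 1) := by
  classical
  have hf : ∀ n, coeff n (fstSeries E f) = if n 1 = 0 then E f (n 0) else 0 := fun n => rfl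
  have hg : ∀ n, coeff n (sndSeries E g) = if n 0 = 0 then E g (n 1) else 0 := fun n => rfl
  have hsum : Finsupp.single 0 (n 0) + Finsupp.single 1 (n 1) = n := by
    ext j
    fin_cases j <;> simp
  rw [coeff_mul, Finset.sum_eq_single (Finsupp.single 0 (n 0), Finsupp.single 1 (n 1))]
  · simp [hf, hg]
  · rintro ⟨p, q⟩ hpq hne
    rw [Finset.HasAntidiagonal.mem_antidiagonal] at hpq
    rw [hf, hg]
    by_cases hp : p 1 = 0
    · by_cases hq : q 0 = 0
      · refine absurd ?_ hne
        have h0 := DFunLike.congr_fun hpq 0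
        have h1 := DFunLike.congr_fun hpq 1
        simp only [Finsupp.add_apply, hp, hq, add_zero, zero_add] at h0 h1
        refine Prod.ext ?_ ?_
        · ext j
          fin_cases j <;> simp [h0, hp]
        · ext j
          fin_cases j <;> simp [h1, hq]
      · simp [hq]
    · simp [hp]
  · intro h
    exact absurd (Finset.HasAntidiagonal.mem_antidiagonal.2 hsum) h

theorem FayIdentity.formal {E : Fn D m → ℕ → Fn D m} {ρ τ : Fn D m} (h : FayIdentity E ρ τ) :
    (X 1 - X 0) * C τ * bothSeries E ρ =
      X 1 * fstSeries E τ * sndSeries E ρ - X 0 * sndSeries E τ * fstSeries E ρ := by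
  have hb : ∀ n, coeff n (bothSeries E ρ) = E (E ρ (n 1)) (n 0) := fun n => rfl
  ext1 n
  rw [mul_right_comm, mul_comm _ (C τ), mul_assoc (X 1), mul_assoc (X 0),
    mul_comm (sndSeries E τ), sub_mul, coeff_C_mul, map_sub, map_sub]
  simp only [coeff_X_mul_eq_delay_update, coeff_fstSeries_mul_sndSeries, hb]
  have key := h (n 0) (n 1)
  have e1 : delay (fun a => E τ ((n.update 1 a) 0) * E ρ ((n.update 1 a) 1)) (n 1) =
      E τ (n 0) * delay (E ρ) (n 1) := by
    cases n 1 <;> simp [delay]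
  have e2 : delay (fun a => E ρ ((n.update 0 a) 0) * E τ ((n.update 0 a) 1)) (n 0) =
      delay (E ρ) (n 0) * E τ (n 1) := by
    cases n 0 <;> simp [delay]
  rw [e1, e2, ← key]
  simp

end Formal

/-! ### Numerical values of the parameters -/

section Numerical

open MvPowerSeries MvPowerSeries.WithPiTopology

variable {𝕜 : Type*} [RCLike 𝕜] {D : ShiftDomain 𝕜} {m : ℕ+}

/-- Sums of formal power series with respect to coefficientwise convergence. -/
theorem hasSum_iff_coeff {ι σ : Type*} {f : ι → MvPowerSeries σ ℂ} {F : MvPowerSeries σ ℂ} :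
    HasSum f F ↔ ∀ α, HasSum (fun i => coeff α (f i)) (coeff α F) :=
  Pi.hasSum

/-- In `ℂ`, (unconditionally) convergent series converge absolutely, so that they can be multiplied. -/
theorem hasSum_complex_mul {ι κ : Type*} {f : ι → ℂ} {g : κ → ℂ} {a b : ℂ}
    (hf : HasSum f a) (hg : HasSum g b) : HasSum (fun p : ι × κ => f p.1 * g p.2) (a * b) :=
  hf.mul hg (summable_mul_of_summable_norm hf.summable.norm hg.summable.norm)

/-- The product of two coefficientwise absolutely convergent series of formal power series. -/
theorem hasSum_mul_mul {ι κ σ : Type*} {f : ι → MvPowerSeries σ ℂ} {g : κ → MvPowerSeries σ ℂ}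
    {F G : MvPowerSeries σ ℂ} (hf : HasSum f F) (hg : HasSum g G) :
    HasSum (fun p : ι × κ => f p.1 * g p.2) (F * G) := by
  classical
  refine hasSum_iff_coeff.2 fun α => ?_
  have hf' := hasSum_iff_coeff.1 hf
  have hg' := hasSum_iff_coeff.1 hg
  simp only [coeff_mul]
  exact hasSum_sum fun q _ => hasSum_complex_mul (f := fun i => coeff q.1 (f i))
    (g := fun i => coeff q.2 (g i)) (hf' q.1) (hg' q.2)

theorem hasSum_delay_snd {σ : Type*} {f : ℕ × ℕ → MvPowerSeries σ ℂ} {F : MvPowerSeries σ ℂ}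
    {y y' : ℂ} (h : HasSum (fun p => (y ^ p.1 * y' ^ p.2) • f p) F) :
    HasSum (fun p : ℕ × ℕ => (y ^ p.1 * y' ^ p.2) • delay (fun j => f (p.1, j)) p.2)
      (y' • F) := by
  have hinj : Function.Injective fun p : ℕ × ℕ => (p.1, p.2 + 1) := by
    rintro ⟨a, b⟩ ⟨a', b'⟩ h
    simpa using h
  refine (hinj.hasSum_iff ?_).1 ?_
  · rintro ⟨a, b⟩ hp
    cases b with
    | zero => simp [delay]
    | succ b => exact absurd ⟨(a, b), rfl⟩ hp
  · convert h.const_smul y' using 1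
    funext p
    simp only [Function.comp_apply, delay, smul_smul]
    congr 1
    ring

theorem hasSum_delay_fst {σ : Type*} {f : ℕ × ℕ → MvPowerSeries σ ℂ} {F : MvPowerSeries σ ℂ}
    {y y' : ℂ} (h : HasSum (fun p => (y ^ p.1 * y' ^ p.2) • f p) F) :
    HasSum (fun p : ℕ × ℕ => (y ^ p.1 * y' ^ p.2) • delay (fun i => f (i, p.2)) p.1)
      (y • F) := by
  have h' : HasSum (fun p : ℕ × ℕ => (y' ^ p.1 * y ^ p.2) • f p.swap) F := by
    convert (Equiv.prodComm ℕ ℕ).hasSum_iff.2 h using 1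
    funext p
    simp [mul_comm]
  convert (Equiv.prodComm ℕ ℕ).hasSum_iff.2 (hasSum_delay_snd h') using 1
  funext p
  simp [mul_comm]

theorem Conv.hasSum {E : Fn D m → ℕ → Fn D m} {f : Fn D m} {s : D.carrier} {y : ℂ}
    (h : Conv E f s y) : HasSum (fun i => y ^ i • evalS s (E f i)) (value E f s y) := by
  rw [hasSum_iff_coeff]
  intro α
  simp only [coeff_smul, mul_comm (y ^ _)]
  exact (h α).hasSum

theorem Conv₂.hasSum {E : Fn D m → ℕ → Fn D m} {f : Fn D m} {s : D.carrier} {y y' : ℂ}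
    (h : Conv₂ E f s y y') :
    HasSum (fun p : ℕ × ℕ => (y ^ p.1 * y' ^ p.2) • evalS s (E (E f p.2) p.1))
      (value₂ E f s y y') := by
  rw [hasSum_iff_coeff]
  intro α
  simp only [coeff_smul, mul_comm (y ^ _ * y' ^ _)]
  exact (h α).hasSum

theorem Conv₂.fst {E : Fn D m → ℕ → Fn D m} (hE : ∀ f, E f 0 = f) {f : Fn D m} {s : D.carrier}
    {y y' : ℂ} (h : Conv₂ E f s y y') : Conv E f s y := by
  intro α
  refine ((h α).comp_injective (i := fun i : ℕ => (i, 0))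
    (fun a b hab => congrArg Prod.fst hab)).congr
    fun i => ?_
  simp [hE]

theorem Conv₂.snd {E : Fn D m → ℕ → Fn D m} (hE : ∀ f, E f 0 = f) {f : Fn D m} {s : D.carrier}
    {y y' : ℂ} (h : Conv₂ E f s y y') : Conv E f s y' := by
  intro α
  refine ((h α).comp_injective (i := fun i : ℕ => (0, i))
    (fun a b hab => congrArg Prod.snd hab)).congr
    fun i => ?_
  simp [hE]

theorem evalS_delay (s : D.carrier) (g : ℕ → Fn D m) (n : ℕ) :
    evalS s (delay g n) = delay (fun j => evalS s (g j)) n := by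
  cases n with
  | zero => exact map_zero (MvPowerSeries.map (Pi.evalRingHom (fun _ => ℂ) s))
  | succ n => rfl

/-- The Fay identity for the sums of the series. No convergence of the single series for `ρ` is
assumed, because they are parts of the double series. -/
theorem FayIdentity.numerical {E : Fn D m → ℕ → Fn D m} (hE : ∀ f, E f 0 = f) {ρ τ : Fn D m}
    (h : FayIdentity E ρ τ) {s : D.carrier} {y y' : ℂ} (hy : Conv E τ s y) (hy' : Conv E τ s y')
    (h₂ : Conv₂ E ρ s y y') :
    (y' - y) • (evalS s τ * value₂ E ρ s y y') =
      y' • (value E τ s y * value E ρ s y') - y • (value E τ s y' * value E ρ s y) := by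
  have hL := ((hasSum_delay_snd (f := fun p => evalS s (E (E ρ p.2) p.1)) h₂.hasSum).sub
    (hasSum_delay_fst (f := fun p => evalS s (E (E ρ p.2) p.1)) h₂.hasSum)).mul_left (evalS s τ)
  have hp : ∀ {f g : Fn D m}, Conv E f s y → Conv E g s y' →
      HasSum (fun p : ℕ × ℕ => (y ^ p.1 * y' ^ p.2) • (evalS s (E f p.1) * evalS s (E g p.2)))
        (value E f s y * value E g s y') := by
    intro f g hf hg
    convert hasSum_mul_mul hf.hasSum hg.hasSum using 1
    funext p
    rw [smul_mul_smul_comm]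
  have hR := (hasSum_delay_snd (f := fun p => evalS s (E τ p.1) * evalS s (E ρ p.2))
    (hp hy (h₂.snd hE))).sub
    (hasSum_delay_fst (f := fun p => evalS s (E ρ p.1) * evalS s (E τ p.2)) (hp (h₂.fst hE) hy'))
  have hmul : ∀ f g : Fn D m, evalS s (f * g) = evalS s f * evalS s g :=
    map_mul (MvPowerSeries.map (Pi.evalRingHom (fun _ => ℂ) s))
  have hsub : ∀ f g : Fn D m, evalS s (f - g) = evalS s f - evalS s g :=
    map_sub (MvPowerSeries.map (Pi.evalRingHom (fun _ => ℂ) s))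
  have hmul_delay : ∀ (a : MvPowerSeries (TimeVar m) ℂ) (g : ℕ → MvPowerSeries (TimeVar m) ℂ) n,
      delay (fun j => a * g j) n = a * delay g n := by
    intro a g n
    cases n <;> simp [delay]
  have hdelay_mul : ∀ (a : MvPowerSeries (TimeVar m) ℂ) (g : ℕ → MvPowerSeries (TimeVar m) ℂ) n,
      delay (fun j => g j * a) n = delay g n * a := by
    intro a g n
    cases n <;> simp [delay]
  have heq := hL.unique (Eq.subst (motive := fun f => HasSum f _) (funext fun p => by
    have key := congrArg (evalS s) (h p.1 p.2)
    simp only [hmul, hsub, evalS_delay] at key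
    simp only [hmul_delay, hdelay_mul]
    rw [← smul_sub, ← smul_sub, ← key, mul_smul_comm]) hR)
  rw [mul_sub, mul_smul_comm, mul_smul_comm] at heq
  rw [sub_smul, heq, mul_comm (value E ρ s y)]

end Numerical

namespace IsTau

variable {𝕜 : Type*} [RCLike 𝕜] [NormedSpace 𝕜 ℂ] {D : ShiftDomain 𝕜} {k m : ℕ+} {τ : Fn D m}

theorem shift_mem_nonZeroDivisors (hτ : IsTau k τ) (i : ℤ) :
    shift i τ ∈ nonZeroDivisors (Fn D m) := by
  rw [← shiftEquiv_apply, ← MulEquivClass.map_nonZeroDivisors (shiftEquiv D m i)]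
  exact ⟨_, mem_nonZeroDivisors_of_evalS_ne_zero hτ.ne_zero, rfl⟩

/-- The Fay identity of the `t`-flows, obtained from the sequence `w_i(s - 1)`. -/
theorem fayIdentity_shiftT (hτ : IsTau k τ) : FayIdentity shiftT (shift (-1) τ) τ := by
  obtain ⟨P, hP, hW, -⟩ := hτ.exists_wave
  have h := hP.isDressing_W.fayIdentity (isFlow_miwaSeries D (-1) TimeVar.t) (timeDer_comm _ _)
    (shift_timeDer 1 _ _) (ρ := shift (-1) τ) (τ := shift (-1) τ)
    (hτ.shift_mem_nonZeroDivisors (-1)) fun i => by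
      rw [← DiffOp.shift_map_mul, hW, coeff_miwaSeries, ← shift_miwa]
      rfl
  rw [shiftEquiv_apply, shift_shift, show (1 : ℤ) + -1 = 0 by norm_num, shift_zero] at h
  simp only [coeff_miwaSeries] at h
  exact h

/-- The Fay identity of the `tbar`-flows, obtained from the sequence `wbar_i(s)`. -/
theorem fayIdentity_shiftTbar (hτ : IsTau k τ) :
    FayIdentity (shiftTbar k) (shift 1 τ) τ := by
  obtain ⟨P, hP, -, hW⟩ := hτ.exists_wave
  have h := hP.isDressing_Wbar.fayIdentity (isFlow_miwaSeries D 1 (tbarVar k m))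
    (timeDer_comm _ _) (shift_timeDer (-1) _ _) (ρ := shift 1 τ) (τ := τ)
    (hτ.shift_mem_nonZeroDivisors 1) fun i => by
      rw [hW, coeff_miwaSeries, ← shift_miwa]
      rfl
  rw [shiftEquiv_apply, shift_shift, show (-1 : ℤ) + 1 = 0 by norm_num, shift_zero] at h
  simp only [coeff_miwaSeries] at h
  exact h

end IsTau

end EBTH

open EBTH MvPowerSeries in
/-- Difference Fay identities. In the first conjunct `X 0`, `X 1` stand for `λ⁻¹`, `μ⁻¹` and the
identity is multiplied by `λ⁻¹ μ⁻¹`, in the second one they stand for `λ`, `μ`. The other two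
conjuncts are the identities for complex numbers `l = λ`, `u = μ`. -/
theorem theorem2p7 {𝕜 : Type*} [RCLike 𝕜] [NormedSpace 𝕜 ℂ] (D : ShiftDomain 𝕜) (k m : ℕ+)
    (τ : Fn D m) (hτ : IsTau k τ) :
    ((X 1 - X 0) * C τ * bothSeries shiftT (shift (-1) τ) =
      X 1 * fstSeries shiftT τ * sndSeries shiftT (shift (-1) τ) -
        X 0 * sndSeries shiftT τ * fstSeries shiftT (shift (-1) τ)) ∧
    ((X 0 - X 1) * bothSeries (shiftTbar k) (shift 1 τ) * C τ =
      X 0 * fstSeries (shiftTbar k) (shift 1 τ) * sndSeries (shiftTbar k) τ -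
        X 1 * sndSeries (shiftTbar k) (shift 1 τ) * fstSeries (shiftTbar k) τ) ∧
    (∀ (s : D.carrier) (l u : ℂ), l ≠ 0 → u ≠ 0 →
      Conv shiftT τ s l⁻¹ → Conv shiftT τ s u⁻¹ → Conv₂ shiftT (shift (-1) τ) s l⁻¹ u⁻¹ →
      (l - u) • (evalS s τ * value₂ shiftT (shift (-1) τ) s l⁻¹ u⁻¹) =
        l • (value shiftT τ s l⁻¹ * value shiftT (shift (-1) τ) s u⁻¹) -
          u • (value shiftT τ s u⁻¹ * value shiftT (shift (-1) τ) s l⁻¹)) ∧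
    (∀ (s : D.carrier) (l u : ℂ), l ≠ 0 → u ≠ 0 →
      Conv (shiftTbar k) τ s l → Conv (shiftTbar k) τ s u →
      Conv₂ (shiftTbar k) (shift 1 τ) s l u →
      (l - u) • (value₂ (shiftTbar k) (shift 1 τ) s l u * evalS s τ) =
        l • (value (shiftTbar k) (shift 1 τ) s l * value (shiftTbar k) τ s u) -
          u • (value (shiftTbar k) (shift 1 τ) s u * value (shiftTbar k) τ s l)) := by
  refine ⟨hτ.fayIdentity_shiftT.formal, ?_, ?_, ?_⟩
  · linear_combination -hτ.fayIdentity_shiftTbar.formal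
  · intro s l u hl hu h1 h2 h3
    have key := FayIdentity.numerical (E := shiftT)
      (fun f => miwa_zero_right (-1) TimeVar.t f) hτ.fayIdentity_shiftT h1 h2 h3
    have e := congrArg (fun F => (l * u) • F) key
    simp only [smul_sub, smul_smul, sub_smul] at e ⊢
    rwa [mul_assoc l u, mul_inv_cancel₀ hu, mul_one, mul_comm l u, mul_assoc u l,
      mul_inv_cancel₀ hl, mul_one] at e
  · intro s l u _ _ h1 h2 h3
    have key := FayIdentity.numerical (E := shiftTbar k)
      (fun f => miwa_zero_right 1 (tbarVar k m) f)
      hτ.fayIdentity_shiftTbar h1 h2 h3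
    rw [← neg_sub u l, neg_smul, mul_comm (value₂ _ _ _ _ _), key, neg_sub,
      mul_comm (value _ τ s u), mul_comm (value _ τ s l)]
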